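/- Let $\mu,z\in\mathbb C$ be fixed. Let $B_n^\mu(z)$, $E_n^\mu(z)$ be the generalized Bernoulli and Euler polynomials, defined near $w=0$ (principal powers) by $$\Big(\frac{w}{e^w-1}\Big)^{\mu}e^{wz}=\sum_{n\ge0}\frac{B_n^\mu(z)}{n!}w^n,\qquad \frac{2^\mu e^{wz}}{(e^w+1)^\mu}=\sum_{n\ge0}\frac{E_n^\mu(z)}{n!}w^n .$$ Let $$f(w)=2^{-3\mu}\pi^{-2\mu}(w^2+4\pi^2)^\mu\Big(\frac{w}{e^w-1}\Big)^\mu e^{wz},\qquad g(w)=\Big(\frac{w^2+\pi^2}{2\pi}\Big)^\mu\Big(\frac1{e^w+1}\Big)^\mu e^{wz},$$ with principal powers near $w=0$; $f$ and $g$ continue analytically to $|w|<4\pi$ and $|w|<3\pi$ respectively. There are unique coefficients such that $$f(w)=\sum_{k\ge0}(\tilde\alpha_k+w\tilde\beta_k)\Big(\frac{w^2+4\pi^2}{w^2}\Big)^k\ \text{ near } w=\pm2\pi i,\qquad g(w)=\sum_{k\ge0}(\tilde\gamma_k+w\tilde\delta_k)\Big(\frac{w^2+\pi^2}{w^2}\Big)^k\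 \text{ near } w=\pm\pi i .$$ They are given by the two-point scheme: with $p=2\pi i$, $f_0=f$, put $\tilde\alpha_j=\frac{f_j(p)+f_j(-p)}2$, $\tilde\beta_j=\frac{f_j(p)-f_j(-p)}{2p}$, $f_{j+1}(w)=\big(f_j(w)-\tilde\alpha_j-w\tilde\beta_j\big)\frac{w^2}{w^2-p^2}$ (singularities at $\pm p$ removed), and likewise $\tilde\gamma_j,\tilde\delta_j$ with $p=\pi i$, $f_0=g$. Put, with $(a)_j=a(a+1)\cdots(a+j-1)$, $$\tilde\Phi_k^{(2n)}=\frac{(-1)^{n+k}}{(2\pi)^{2\mu+2n}}\frac{(\mu-k)_{n+k}}{(n+k)!},\qquad \tilde\Psi_k^{(2n)}=\frac{(-1)^{n+k}}{\pi^{2\mu+2n}}\frac{(\mu-k)_{n+k}}{(n+k)!};$$ here $(\mu-k)_{n+k}=\Gamma(\mu+n)/\Gamma(\mu-k)$ (with $1/\Gamma=0$ at the poles of $\Gamma$) whenever $\mu+n\notin\{0,-1,-2,\dots\}$. Then, as $n\to\infty$, $$B_{2n}^\mu(z)\sim(2n)!\,2^{3\mu}\pi^{2\mu}\sum_{k\ge0}\tilde\alpha_k\tilde\Phi_k^{(2n)},\qquad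 B_{2n+1}^\mu(z)\sim(2n+1)!\,2^{3\mu}\pi^{2\mu}\sum_{k\ge0}\tilde\beta_k\tilde\Phi_k^{(2n)},$$ $$E_{2n}^\mu(z)\sim(2n)!\,(4\pi)^{\mu}\sum_{k\ge0}\tilde\gamma_k\tilde\Psi_k^{(2n)},\qquad E_{2n+1}^\mu(z)\sim(2n+1)!\,(4\pi)^{\mu}\sum_{k\ge0}\tilde\delta_k\tilde\Psi_k^{(2n)},$$ in the following sense. For every $N\ge0$ the difference between the left side and the sum of the terms with $k<N$ is $O\big((2n)!\,(2\pi)^{-2n}n^{\operatorname{Re}\mu-N-1}\big)$, respectively $O\big((2n+1)!\,(2\pi)^{-2n}n^{\operatorname{Re}\mu-N-1}\big)$, with $\pi$ in place of $2\pi$ in the Euler case. If $\mu\notin\mathbb Z$, then moreover $\tilde\Phi_{k+1}^{(2n)}=o(\tilde\Phi_k^{(2n)})$ for every $k$, the remainder after the terms with $k<N$ is $O\big((2n)!\,\tilde\Phi_N^{(2n)}\big)$, respectively $O\big((2n+1)!\,\tilde\Phi_N^{(2n)}\big)$, and the same holds with $\tilde\Psi$ in the Euler case. If $\mu\notin\mathbb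 Z$, the series $\sum_k\tilde\alpha_k\tilde\Phi_k^{(2n)}$ and $\sum_k\tilde\gamma_k\tilde\Psi_k^{(2n)}$ diverge for every $n\ge0$, and so do $\sum_k\tilde\beta_k\tilde\Phi_k^{(2n)}$ and $\sum_k\tilde\delta_k\tilde\Psi_k^{(2n)}$ if in addition $z\ne\mu/2$. If $\mu=m$ is a positive integer, then $\tilde\Phi_k^{(2n)}=\tilde\Psi_k^{(2n)}=0$ for all $k\ge m$ and all $n$, so the series terminate; if $\mu=-m$ with $m\ge0$ an integer, all $\tilde\Phi_k^{(2n)},\tilde\Psi_k^{(2n)}$ with $n>m$ vanish. If $\mu=1$, only $k=0$ remains, $\tilde\Phi_0^{(2n)}=(-1)^n/(2\pi)^{2n+2}$, $\tilde\Psi_0^{(2n)}=(-1)^n/\pi^{2n+2}$, and the four right-hand sides above are exactly the leading terms of the Fourier expansions of $B_{2n}(z),B_{2n+1}(z),E_{2n}(z),E_{2n+1}(z)$ on $(0,1)$, namely $$2(-1)^{n+1}(2n)!\frac{\cos 2\pi z}{(2\pi)^{2n}},\quad 2(-1)^{n+1}(2n+1)!\frac{\sin2\pi z}{(2\pi)^{2n+1}},\quad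 4\,(2n)!\frac{\sin(\pi z-\pi n)}{\pi^{2n+1}},\quad 4\,(2n+1)!\frac{\sin(\pi z-\frac{\pi}{2}(2n+1))}{\pi^{2n+2}} .$$ -/

import Mathlib

open Filter Topology Asymptotics
open scoped Nat

noncomputable section

namespace LargeDegree

/-- The function `w / (e^w - 1)`, with its removable singularity at `0` filled in. -/
def bernoulliBase (w : ℂ) : ℂ :=
  if w = 0 then 1 else w / (Complex.exp w - 1)

/-- The generalized Bernoulli polynomial `B_n^μ(z)`: `n!` times the `n`-th Taylor coefficient at
`w = 0` of `(w / (e^w - 1))^μ e^{wz}`. Near `w = 0` the base of the power is near `1`, and the power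
is the principal one. -/
def genBernoulli (μ : ℂ) (n : ℕ) (z : ℂ) : ℂ :=
  iteratedDeriv n (fun w : ℂ => bernoulliBase w ^ μ * Complex.exp (w * z)) 0

/-- The generalized Euler polynomial `E_n^μ(z)`: `n!` times the `n`-th Taylor coefficient at
`w = 0` of `2^μ e^{wz} / (e^w + 1)^μ` (principal powers near `w = 0`). -/
def genEuler (μ : ℂ) (n : ℕ) (z : ℂ) : ℂ :=
  iteratedDeriv n
    (fun w : ℂ => (2 : ℂ) ^ μ * Complex.exp (w * z) / (Complex.exp w + 1) ^ μ) 0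

/-- The continuation of a germ at `0` by its Taylor series at `0`. -/
def taylorContinuation (F : ℂ → ℂ) (w : ℂ) : ℂ :=
  ∑' n : ℕ, iteratedDeriv n F 0 / (n ! : ℂ) * w ^ n

/-- `2^{-3μ} π^{-2μ} (w² + 4π²)^μ (w / (e^w - 1))^μ e^{wz}` for `w` near `0`, principal powers. -/
def fGerm (μ z w : ℂ) : ℂ :=
  (2 : ℂ) ^ (-3 * μ) * (Real.pi : ℂ) ^ (-2 * μ) * (w ^ 2 + 4 * (Real.pi : ℂ) ^ 2) ^ μ *
    bernoulliBase w ^ μ * Complex.exp (w * z)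

/-- The function `f`, analytic in `|w| < 4π`, that continues `fGerm`. -/
def f (μ z : ℂ) : ℂ → ℂ := taylorContinuation (fGerm μ z)

/-- `((w² + π²) / (2π))^μ (1 / (e^w + 1))^μ e^{wz}` for `w` near `0`, principal powers. -/
def gGerm (μ z w : ℂ) : ℂ :=
  ((w ^ 2 + (Real.pi : ℂ) ^ 2) / (2 * (Real.pi : ℂ))) ^ μ * (1 / (Complex.exp w + 1)) ^ μ *
    Complex.exp (w * z)

/-- The function `g`, analytic in `|w| < 3π`, that continues `gGerm`. -/
def g (μ z : ℂ) : ℂ → ℂ := taylorContinuation (gGerm μ z)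

/-- `a` in the interpolating polynomial `a + w b` of `F` at the two points `±p`. -/
def interpA (p : ℂ) (F : ℂ → ℂ) : ℂ := (F p + F (-p)) / 2

/-- `b` in the interpolating polynomial `a + w b` of `F` at the two points `±p`. -/
def interpB (p : ℂ) (F : ℂ → ℂ) : ℂ := (F p - F (-p)) / (2 * p)

/-- The functions `F_0 = F`, `F_{j+1}(w) = (F_j(w) - (a_j + w b_j)) · w² / (w² - p²)`, where
`a_j + w b_j` interpolates `F_j` at `±p`. The quotient by `w² - p² = (w - p) (w + p)` is written
with `dslope`, which fills in the removable singularities at `w = ±p`. -/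
def twoPointRem (p : ℂ) (F : ℂ → ℂ) : ℕ → ℂ → ℂ
  | 0 => F
  | j + 1 => fun w =>
      w ^ 2 * dslope (dslope (fun v => twoPointRem p F j v -
        (interpA p (twoPointRem p F j) + v * interpB p (twoPointRem p F j))) p) (-p) w

/-- The coefficient `a_k` in `F(w) = ∑ (a_k + w b_k) ((w² - p²) / w²)^k`. -/
def twoPointA (p : ℂ) (F : ℂ → ℂ) (k : ℕ) : ℂ := interpA p (twoPointRem p F k)

/-- The coefficient `b_k` in `F(w) = ∑ (a_k + w b_k) ((w² - p²) / w²)^k`. -/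
def twoPointB (p : ℂ) (F : ℂ → ℂ) (k : ℕ) : ℂ := interpB p (twoPointRem p F k)

/-- The point `2πi`. -/
def pB : ℂ := 2 * (Real.pi : ℂ) * Complex.I

/-- The point `πi`. -/
def pE : ℂ := (Real.pi : ℂ) * Complex.I

/-- The coefficients of the expansion of `f` in powers of `(w² + 4π²) / w²`. -/
def alphaT (μ z : ℂ) (k : ℕ) : ℂ := twoPointA pB (f μ z) k
/-- The coefficients multiplied by `w` in the expansion of `f`. -/
def betaT (μ z : ℂ) (k : ℕ) : ℂ := twoPointB pB (f μ z) k

/-- The coefficients of the expansion of `g` in powers of `(w² + π²) / w²`. -/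
def gammaT (μ z : ℂ) (k : ℕ) : ℂ := twoPointA pE (g μ z) k
/-- The coefficients multiplied by `w` in the expansion of `g`. -/
def deltaT (μ z : ℂ) (k : ℕ) : ℂ := twoPointB pE (g μ z) k

/-- `Φ̃_k^{(2n)} = (-1)^{n+k} (2π)^{-2μ-2n} (μ-k)_{n+k} / (n+k)!`. -/
def PhiT (μ : ℂ) (k n : ℕ) : ℂ :=
  (-1) ^ (n + k) * (2 * (Real.pi : ℂ)) ^ (-2 * μ - 2 * (n : ℂ)) *
    (ascPochhammer ℂ (n + k)).eval (μ - k) / ((n + k)! : ℂ)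

/-- `Ψ̃_k^{(2n)} = (-1)^{n+k} π^{-2μ-2n} (μ-k)_{n+k} / (n+k)!`. -/
def PsiT (μ : ℂ) (k n : ℕ) : ℂ :=
  (-1) ^ (n + k) * (Real.pi : ℂ) ^ (-2 * μ - 2 * (n : ℂ)) *
    (ascPochhammer ℂ (n + k)).eval (μ - k) / ((n + k)! : ℂ)

/-- `u ∼ ∑ a_k t_k` as `n → ∞`, a generalized asymptotic expansion with respect to the asymptotic
scale `s`: the remainder after `N` terms is `O(s_N)`, for every `N`. -/
def HasAsympExpansion (u : ℕ → ℂ) (a : ℕ → ℂ) (t s : ℕ → ℕ → ℂ) : Prop :=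
  (∀ k, s (k + 1) =o[atTop] s k) ∧
    ∀ N, (fun n => u n - ∑ k ∈ Finset.range N, a k * t k n) =O[atTop] s N

/-- The partial sums of the series `∑ t_k` have no limit. -/
def SeriesDiverges (t : ℕ → ℂ) : Prop :=
  ¬ ∃ l : ℂ, Tendsto (fun N => ∑ k ∈ Finset.range N, t k) atTop (𝓝 l)

/-- The prefactor `N! 2^{3μ} π^{2μ}`. -/
def prefB (μ : ℂ) (N : ℕ) : ℂ := (N ! : ℂ) * (2 : ℂ) ^ (3 * μ) * (Real.pi : ℂ) ^ (2 * μ)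

/-- The prefactor `N! (4π)^μ`. -/
def prefE (μ : ℂ) (N : ℕ) : ℂ := (N ! : ℂ) * (4 * (Real.pi : ℂ)) ^ μ

end LargeDegree

end

noncomputable section

namespace LargeDegree

/-- The `n`-th Taylor coefficient of `F` at `0`. -/
def taylorCoeff (F : ℂ → ℂ) (n : ℕ) : ℂ := iteratedDeriv n F 0 / (n ! : ℂ)

theorem taylorCoeff_congr {F G : ℂ → ℂ} (h : F =ᶠ[𝓝 0] G) (n : ℕ) :
    taylorCoeff F n = taylorCoeff G n := by
  rw [taylorCoeff, taylorCoeff, h.iteratedDeriv_eq]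

theorem iteratedDeriv_eq_taylorCoeff (F : ℂ → ℂ) (n : ℕ) :
    iteratedDeriv n F 0 = (n ! : ℂ) * taylorCoeff F n := by
  rw [taylorCoeff, mul_div_cancel₀ _ (by exact_mod_cast n.factorial_ne_zero)]

theorem taylorCoeff_eq_of_hasSum {F : ℂ → ℂ} {c : ℕ → ℂ}
    (h : ∀ᶠ w in 𝓝 (0 : ℂ), HasSum (fun n => c n * w ^ n) (F w)) (n : ℕ) :
    taylorCoeff F n = c n := by
  have h1 : HasFPowerSeriesAt F (FormalMultilinearSeries.ofScalars ℂ c) 0 := by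
    rw [hasFPowerSeriesAt_iff]
    filter_upwards [h] with w hw
    simpa [mul_comm] using hw
  have h2 := h1.eq_formalMultilinearSeries h1.analyticAt.hasFPowerSeriesAt
  have h3 := congrArg (fun s => FormalMultilinearSeries.coeff s n) h2
  simp only [FormalMultilinearSeries.coeff_ofScalars] at h3
  exact h3.symm

theorem eventually_hasSum_taylorCoeff {F : ℂ → ℂ} (hF : AnalyticAt ℂ F 0) :
    ∀ᶠ w in 𝓝 (0 : ℂ), HasSum (fun n => taylorCoeff F n * w ^ n) (F w) := by
  have h := hasFPowerSeriesAt_iff.1 hF.hasFPowerSeriesAt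
  filter_upwards [h] with w hw
  simpa [mul_comm, taylorCoeff] using hw

theorem hasSum_taylorCoeff_ball {F : ℂ → ℂ} {R : ℝ} (hF : DifferentiableOn ℂ F (Metric.ball 0 R))
    {w : ℂ} (hw : w ∈ Metric.ball (0 : ℂ) R) :
    HasSum (fun n => taylorCoeff F n * w ^ n) (F w) := by
  convert! Complex.hasSum_taylorSeries_on_ball hF hw using 2 with n
  simp only [taylorCoeff, sub_zero, smul_eq_mul]
  ring

theorem taylorCoeff_mul {F G : ℂ → ℂ} (hF : AnalyticAt ℂ F 0) (hG : AnalyticAt ℂ G 0) (n : ℕ) :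
    taylorCoeff (fun w => F w * G w) n =
      ∑ x ∈ Finset.HasAntidiagonal.antidiagonal n, taylorCoeff F x.1 * taylorCoeff G x.2 := by
  rw [taylorCoeff, iteratedDeriv_fun_mul hF.contDiffAt hG.contDiffAt,
    Finset.Nat.sum_antidiagonal_eq_sum_range_succ
      (fun i j => taylorCoeff F i * taylorCoeff G j), Finset.sum_div]
  refine Finset.sum_congr rfl fun i hi => ?_
  have hi' : i ≤ n := Nat.lt_succ_iff.1 (Finset.mem_range.1 hi)
  have h1 : ((n.choose i : ℕ) : ℂ) * i ! * (n - i)! = n ! := by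
    exact_mod_cast Nat.choose_mul_factorial_mul_factorial hi'
  have h2 : (n ! : ℂ) ≠ 0 := by exact_mod_cast n.factorial_ne_zero
  have h3 : (i ! : ℂ) ≠ 0 := by exact_mod_cast i.factorial_ne_zero
  have h4 : ((n - i)! : ℂ) ≠ 0 := by exact_mod_cast (n - i).factorial_ne_zero
  simp only [taylorCoeff]
  have h5 : ((n.choose i : ℕ) : ℂ) ≠ 0 := by exact_mod_cast (Nat.choose_pos hi').ne'
  rw [← h1]
  field_simp

theorem taylorCoeff_add {F G : ℂ → ℂ} (hF : AnalyticAt ℂ F 0) (hG : AnalyticAt ℂ G 0) (n : ℕ) :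
    taylorCoeff (fun w => F w + G w) n = taylorCoeff F n + taylorCoeff G n := by
  rw [taylorCoeff, iteratedDeriv_fun_add hF.contDiffAt hG.contDiffAt, add_div]
  rfl

theorem taylorCoeff_const_mul (F : ℂ → ℂ) (c : ℂ) (n : ℕ) :
    taylorCoeff (fun w => c * F w) n = c * taylorCoeff F n := by
  rw [taylorCoeff, iteratedDeriv_const_mul_field, taylorCoeff, mul_div_assoc]

theorem taylorCoeff_id_mul {F : ℂ → ℂ} (hF : AnalyticAt ℂ F 0) (n : ℕ) :
    taylorCoeff (fun w => w * F w) n = if n = 0 then 0 else taylorCoeff F (n - 1) := by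
  refine taylorCoeff_eq_of_hasSum (c := fun n => if n = 0 then 0 else taylorCoeff F (n - 1)) ?_ n
  filter_upwards [eventually_hasSum_taylorCoeff hF] with w hw
  rw [← hasSum_nat_add_iff' 1]
  simpa [pow_succ, mul_comm, mul_left_comm, mul_assoc] using hw.mul_left w

theorem taylorCoeff_sq_mul {F : ℂ → ℂ} (hF : AnalyticAt ℂ F 0) (n : ℕ) :
    taylorCoeff (fun w => w ^ 2 * F w) (n + 2) = taylorCoeff F n := by
  have h : (fun w => w ^ 2 * F w) = fun w => w * (w * F w) := by ext w; ring
  rw [h, taylorCoeff_id_mul (F := fun w => w * F w) (analyticAt_id.mul hF), if_neg (by omega),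
    show n + 2 - 1 = n + 1 from rfl, taylorCoeff_id_mul hF, if_neg (by omega), Nat.add_sub_cancel]

/-- The binomial factor `(1 + w² / r²)^ν`. -/
def binomFactor (r : ℝ) (ν : ℂ) (w : ℂ) : ℂ := (1 + w ^ 2 / (r : ℂ) ^ 2) ^ ν

theorem analyticAt_binomFactor (r : ℝ) (ν : ℂ) : AnalyticAt ℂ (binomFactor r ν) 0 := by
  unfold binomFactor
  refine AnalyticAt.cpow (by fun_prop) analyticAt_const ?_
  simp

theorem binomFactor_add_one (r : ℝ) (ν : ℂ) :
    binomFactor r (ν + 1) =ᶠ[𝓝 0] fun w => binomFactor r ν w * (1 + w ^ 2 / (r : ℂ) ^ 2) := by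
  have h : ∀ᶠ w : ℂ in 𝓝 0, 1 + w ^ 2 / (r : ℂ) ^ 2 ≠ 0 :=
    ContinuousAt.eventually_ne (by fun_prop) (by simp)
  filter_upwards [h] with w hw
  rw [binomFactor, Complex.cpow_add _ _ hw, Complex.cpow_one, binomFactor]

theorem eventually_hasSum_binomFactor (r : ℝ) (ν : ℂ) :
    ∀ᶠ w in 𝓝 (0 : ℂ), HasSum (fun m : ℕ => Ring.choose ν m / (r : ℂ) ^ (2 * m) * w ^ (2 * m))
      (binomFactor r ν w) := by
  have h1 := hasFPowerSeriesAt_iff.1 (Complex.one_add_cpow_hasFPowerSeriesAt_zero (a := ν))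
  have h2 : Tendsto (fun w : ℂ => w ^ 2 / (r : ℂ) ^ 2) (𝓝 0) (𝓝 0) := by
    have : ContinuousAt (fun w : ℂ => w ^ 2 / (r : ℂ) ^ 2) 0 := by fun_prop
    simpa [ContinuousAt] using this
  filter_upwards [h2.eventually h1] with w hw
  rw [zero_add] at hw
  refine HasSum.congr_fun hw fun m => ?_
  simp only [binomialSeries, FormalMultilinearSeries.coeff_ofScalars, smul_eq_mul, div_pow, pow_mul]
  ring

theorem taylorCoeff_binomFactor_even (r : ℝ) (ν : ℂ) (m : ℕ) :
    taylorCoeff (binomFactor r ν) (2 * m) = Ring.choose ν m / (r : ℂ) ^ (2 * m) ∧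
    taylorCoeff (binomFactor r ν) (2 * m + 1) = 0 := by
  have h := taylorCoeff_eq_of_hasSum (F := binomFactor r ν)
    (c := fun n => if Even n then Ring.choose ν (n / 2) / (r : ℂ) ^ n else 0) (by
      filter_upwards [eventually_hasSum_binomFactor r ν] with w hw
      rw [← (mul_right_injective₀ (two_ne_zero' ℕ)).hasSum_iff]
      · simpa [Function.comp_def] using hw
      · intro n hn
        have : ¬ Even n := by
          rintro ⟨k, rfl⟩
          exact hn ⟨k, by simp [two_mul]⟩
        simp [this])
  refine ⟨by simp [h], ?_⟩
  rw [h, if_neg (by simp)]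

theorem ringChoose_eq_ascPochhammer (s : ℂ) (m : ℕ) :
    Ring.choose (-s) m = (-1) ^ m * (ascPochhammer ℂ m).eval s / (m ! : ℂ) := by
  have h := Ring.descPochhammer_eq_factorial_smul_choose (-s) m
  have h2 : (m ! : ℂ) ≠ 0 := by exact_mod_cast m.factorial_ne_zero
  rw [eq_div_iff h2, mul_comm, ← nsmul_eq_mul, ← h]
  have h3 := Polynomial.ascPochhammer_smeval_neg_eq_descPochhammer (-s) m
  rw [neg_neg, Polynomial.ascPochhammer_smeval_eq_eval] at h3
  rw [h3]
  rcases Nat.even_or_odd m with hm | hm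
  · rw [Int.negOnePow_even _ (by exact_mod_cast hm), hm.neg_one_pow, one_smul, one_mul]
  · rw [Int.negOnePow_odd _ (by exact_mod_cast hm), hm.neg_one_pow, Units.neg_smul, one_smul,
      neg_one_mul, neg_neg]

theorem ascPochhammer_eval_eq_prod (s : ℂ) (n : ℕ) :
    (ascPochhammer ℂ n).eval s = ∏ j ∈ Finset.range n, (s + j) := by
  induction n with
  | zero => simp
  | succ n ih => rw [ascPochhammer_succ_eval, ih, Finset.prod_range_succ]

theorem ascPochhammer_eval_ne_zero {s : ℂ} (hs : ∀ m : ℕ, s ≠ -m) (n : ℕ) :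
    (ascPochhammer ℂ n).eval s ≠ 0 := by
  rw [ascPochhammer_eval_eq_prod]
  exact Finset.prod_ne_zero_iff.2 fun j _ h => hs j (eq_neg_of_add_eq_zero_left h)

theorem tendsto_natCast_div_add (s : ℂ) : Tendsto (fun n : ℕ => (n : ℂ) / (s + n)) atTop (𝓝 1) := by
  have h := tendsto_natCast_div_add_atTop (𝕜 := ℂ) s
  simpa [add_comm] using h

theorem isTheta_ascPochhammer {s : ℂ} (hs : ∀ m : ℕ, s ≠ -m) :
    (fun n : ℕ => (ascPochhammer ℂ n).eval s / (n ! : ℂ)) =Θ[atTop] fun n : ℕ => (n : ℂ) ^ (s - 1) := by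
  have h1 := (tendsto_natCast_div_add s).div (Complex.GammaSeq_tendsto_Gamma s)
    (Complex.Gamma_ne_zero hs)
  refine IsTheta.symm <| isTheta_of_div_tendsto_nhds_ne_zero (c := 1 / Complex.Gamma s) ?_
    (one_div_ne_zero (Complex.Gamma_ne_zero hs))
  refine h1.congr' ?_
  filter_upwards [eventually_ge_atTop 1] with n hn
  have hn' : (n : ℂ) ≠ 0 := by exact_mod_cast (by omega : n ≠ 0)
  have h2 : (n ! : ℂ) ≠ 0 := by exact_mod_cast n.factorial_ne_zero
  have h3 : (n : ℂ) ^ s ≠ 0 := by simp [Complex.cpow_eq_zero_iff, hn']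
  have h4 : s + n ≠ 0 := fun h => hs n (eq_neg_of_add_eq_zero_left h)
  have h5 := ascPochhammer_eval_ne_zero hs n
  rw [ascPochhammer_eval_eq_prod] at h5 ⊢
  simp only [Pi.div_apply, Complex.GammaSeq, Finset.prod_range_succ, Complex.cpow_sub _ _ hn',
    Complex.cpow_one]
  field_simp

theorem isBigO_ascPochhammer (s : ℂ) :
    (fun n : ℕ => (ascPochhammer ℂ n).eval s / (n ! : ℂ)) =O[atTop] fun n : ℕ => (n : ℂ) ^ (s - 1) := by
  by_cases hs : ∀ m : ℕ, s ≠ -m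
  · exact (isTheta_ascPochhammer hs).1
  · push Not at hs
    obtain ⟨m, rfl⟩ := hs
    refine IsBigO.of_bound 1 ?_
    filter_upwards [eventually_gt_atTop m] with n hn
    rw [(ascPochhammer_eval_eq_zero_iff n _).2 ⟨m, hn, by simp⟩]
    simp

theorem rpow_le_rpow_abs_mul {x y t : ℝ} (hx : 0 < x) (hy : 0 < y) (ht : 1 ≤ t) (hxy : x ≤ t * y)
    (hyx : y ≤ t * x) (a : ℝ) : x ^ a ≤ t ^ |a| * y ^ a := by
  have ht0 : 0 < t := by linarith
  rcases le_total 0 a with ha | ha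
  · rw [abs_of_nonneg ha, ← Real.mul_rpow ht0.le hy.le]
    exact Real.rpow_le_rpow hx.le hxy ha
  · rw [abs_of_nonpos ha, Real.rpow_neg ht0.le, ← Real.inv_rpow ht0.le,
      ← Real.mul_rpow (inv_nonneg.2 ht0.le) hy.le]
    refine Real.rpow_le_rpow_of_nonpos (by positivity) ?_ ha
    rw [inv_mul_le_iff₀ ht0]
    exact hyx

theorem summable_rpow_mul_geometric (b : ℝ) {q : ℝ} (hq : 0 < q) (hq1 : q < 1) :
    Summable fun j : ℕ => ((j : ℝ) + 1) ^ b * q ^ j := by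
  have h1 : Summable fun j : ℕ => (j : ℝ) ^ ⌈b⌉₊ * q ^ j :=
    summable_pow_mul_geometric_of_norm_lt_one _ (by rwa [Real.norm_of_nonneg hq.le])
  have h2 := ((summable_nat_add_iff 1).2 h1).mul_left q⁻¹
  refine Summable.of_nonneg_of_le (fun j => by positivity) (fun j => ?_) h2
  have h3 : ((j : ℝ) + 1) ^ b ≤ ((j : ℝ) + 1) ^ ⌈b⌉₊ := by
    rw [← Real.rpow_natCast]
    exact Real.rpow_le_rpow_of_exponent_le (by simp) (Nat.le_ceil b)
  calc ((j : ℝ) + 1) ^ b * q ^ j ≤ ((j : ℝ) + 1) ^ ⌈b⌉₊ * q ^ j := by gcongr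
    _ = _ := by push_cast; rw [pow_succ]; field_simp

theorem norm_convolution_le {h c : ℕ → ℂ} {r ρ C C' a : ℝ} (hr : 0 < r) (hρ : r < ρ)
    (hh : ∀ j, ‖h j‖ ≤ C' / ρ ^ j) (hc : ∀ i, ‖c i‖ ≤ C * ((i : ℝ) + 1) ^ a / r ^ i) :
    ∃ K, ∀ M : ℕ, ‖∑ x ∈ Finset.HasAntidiagonal.antidiagonal M, h x.1 * c x.2‖ ≤
      K * ((M : ℝ) + 1) ^ a / r ^ M := by
  have hρ0 : 0 < ρ := hr.trans hρ
  have hC' : 0 ≤ C' := by simpa using (norm_nonneg _).trans (hh 0)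
  have hC : 0 ≤ C := by simpa using (norm_nonneg _).trans (hc 0)
  have hs := summable_rpow_mul_geometric |a| (div_pos hr hρ0) ((div_lt_one hρ0).2 hρ)
  refine ⟨C * C' * ∑' j : ℕ, ((j : ℝ) + 1) ^ |a| * (r / ρ) ^ j, fun M => ?_⟩
  have key : ∀ x ∈ Finset.HasAntidiagonal.antidiagonal M, ‖h x.1 * c x.2‖ ≤
      C * C' * ((M : ℝ) + 1) ^ a / r ^ M * (((x.1 : ℝ) + 1) ^ |a| * (r / ρ) ^ x.1) := by
    rintro ⟨j, i⟩ hx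
    have hM : j + i = M := by simpa using hx
    subst hM
    have hj : (0 : ℝ) ≤ j := j.cast_nonneg
    have hi : (0 : ℝ) ≤ i := i.cast_nonneg
    have h1 : ((i : ℝ) + 1) ^ a ≤ ((j : ℝ) + 1) ^ |a| * (((j + i : ℕ) : ℝ) + 1) ^ a := by
      refine rpow_le_rpow_abs_mul (by positivity) (by positivity) (by linarith) ?_ ?_ a <;>
      · push_cast; nlinarith
    calc ‖h j * c i‖ = ‖h j‖ * ‖c i‖ := norm_mul _ _
      _ ≤ (C' / ρ ^ j) * (C * (((j : ℝ) + 1) ^ |a| * (((j + i : ℕ) : ℝ) + 1) ^ a) / r ^ i) := by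
        refine mul_le_mul (hh j) ((hc i).trans ?_) (norm_nonneg _) (by positivity)
        gcongr
      _ = _ := by
        rw [pow_add, div_pow]
        field_simp
  calc ‖∑ x ∈ Finset.HasAntidiagonal.antidiagonal M, h x.1 * c x.2‖
      ≤ ∑ x ∈ Finset.HasAntidiagonal.antidiagonal M,
        C * C' * ((M : ℝ) + 1) ^ a / r ^ M * (((x.1 : ℝ) + 1) ^ |a| * (r / ρ) ^ x.1) :=
        norm_sum_le_of_le _ key
    _ = C * C' * ((M : ℝ) + 1) ^ a / r ^ M *
        ∑ j ∈ Finset.range M.succ, (((j : ℝ) + 1) ^ |a| * (r / ρ) ^ j) := by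
        rw [← Finset.mul_sum, Finset.Nat.sum_antidiagonal_eq_sum_range_succ
          (fun j _ => ((j : ℝ) + 1) ^ |a| * (r / ρ) ^ j)]
    _ ≤ C * C' * ((M : ℝ) + 1) ^ a / r ^ M * ∑' j : ℕ, ((j : ℝ) + 1) ^ |a| * (r / ρ) ^ j := by
        refine mul_le_mul_of_nonneg_left (hs.sum_le_tsum _ fun j _ => by positivity) (by positivity)
    _ = _ := by ring

theorem exists_norm_taylorCoeff_le {F : ℂ → ℂ} {ρ R : ℝ} (hρ : 0 < ρ) (hρR : ρ < R)
    (hF : DifferentiableOn ℂ F (Metric.ball 0 R)) : ∃ C, ∀ n, ‖taylorCoeff F n‖ ≤ C / ρ ^ n := by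
  have h := hasSum_taylorCoeff_ball hF (w := (ρ : ℂ)) (by simpa [abs_of_pos hρ] using hρR)
  obtain ⟨C, hC⟩ := (h.summable.tendsto_atTop_zero.norm.bddAbove_range)
  refine ⟨C, fun n => ?_⟩
  rw [le_div_iff₀ (by positivity)]
  have := hC (Set.mem_range_self n)
  simpa [abs_of_pos hρ] using this

theorem exists_norm_taylorCoeff_binomFactor_le {r : ℝ} (hr : 0 < r) (ν : ℂ) :
    ∃ C, ∀ n : ℕ, ‖taylorCoeff (binomFactor r ν) n‖ ≤ C * ((n : ℝ) + 1) ^ (-ν.re - 1) / r ^ n := by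
  have h0 : (fun n : ℕ => (ascPochhammer ℂ n).eval (-ν) / (n ! : ℂ)) =O[atTop]
      fun n : ℕ => ((n : ℝ) + 1) ^ (-ν.re - 1) := by
    refine (isBigO_ascPochhammer (-ν)).trans ?_
    refine IsBigO.of_bound (2 ^ |-ν.re - 1|) ?_
    filter_upwards [eventually_ge_atTop 1] with n hn
    have hn' : (1 : ℝ) ≤ n := by exact_mod_cast hn
    rw [Complex.norm_natCast_cpow_of_pos hn, Real.norm_of_nonneg (by positivity)]
    simp only [Complex.sub_re, Complex.neg_re, Complex.one_re]
    exact rpow_le_rpow_abs_mul (by linarith) (by linarith) (by norm_num) (by linarith)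
      (by linarith) _
  obtain ⟨C, hC0, hC⟩ := bound_of_isBigO_nat_atTop h0
  refine ⟨C * 2 ^ |-ν.re - 1|, fun n => ?_⟩
  rcases Nat.even_or_odd' n with ⟨m, rfl | rfl⟩
  · have hm := hC (x := m) (by positivity)
    rw [Real.norm_of_nonneg (by positivity)] at hm
    have h1 := ringChoose_eq_ascPochhammer (-ν) m
    rw [neg_neg, mul_div_assoc] at h1
    rw [(taylorCoeff_binomFactor_even r ν m).1, norm_div, norm_pow, Complex.norm_real,
      Real.norm_of_nonneg hr.le, h1, norm_mul, norm_pow, norm_neg, norm_one, one_pow, one_mul]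
    have h2 : ((m : ℝ) + 1) ^ (-ν.re - 1) ≤
        2 ^ |-ν.re - 1| * (((2 * m : ℕ) : ℝ) + 1) ^ (-ν.re - 1) := by
      have : (0 : ℝ) ≤ m := m.cast_nonneg
      refine rpow_le_rpow_abs_mul (by positivity) (by positivity) (by norm_num) ?_ ?_ _ <;>
      · push_cast; linarith
    gcongr
    calc _ ≤ _ := hm
      _ ≤ _ := by rw [mul_assoc]; gcongr
  · rw [(taylorCoeff_binomFactor_even r ν m).2, norm_zero]
    positivity

theorem exists_norm_taylorCoeff_mul_binomFactor_le {F : ℂ → ℂ} {r R : ℝ} (hr : 0 < r) (hrR : r < R)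
    (hF : DifferentiableOn ℂ F (Metric.ball 0 R)) (ν : ℂ) :
    ∃ K, ∀ M : ℕ, ‖taylorCoeff (fun w => F w * binomFactor r ν w) M‖ ≤
      K * ((M : ℝ) + 1) ^ (-ν.re - 1) / r ^ M := by
  obtain ⟨ρ, h1, h2⟩ := exists_between hrR
  obtain ⟨C', hC'⟩ := exists_norm_taylorCoeff_le (hr.trans h1) h2 hF
  obtain ⟨C, hC⟩ := exists_norm_taylorCoeff_binomFactor_le hr ν
  obtain ⟨K, hK⟩ := norm_convolution_le hr h1 hC' hC
  refine ⟨K, fun M => ?_⟩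
  rw [taylorCoeff_mul (hF.analyticAt (Metric.ball_mem_nhds _ (hr.trans hrR)))
    (analyticAt_binomFactor r ν)]
  exact hK M

theorem differentiableOn_twoPointRem {p : ℂ} {F : ℂ → ℂ} {R : ℝ} (hp : ‖p‖ < R)
    (hF : DifferentiableOn ℂ F (Metric.ball 0 R)) (j : ℕ) :
    DifferentiableOn ℂ (twoPointRem p F j) (Metric.ball 0 R) := by
  induction j with
  | zero => exact hF
  | succ j ih =>
    have h1 : Metric.ball (0 : ℂ) R ∈ 𝓝 p := Metric.isOpen_ball.mem_nhds (by simpa using hp)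
    have h2 : Metric.ball (0 : ℂ) R ∈ 𝓝 (-p) := Metric.isOpen_ball.mem_nhds (by simpa using hp)
    refine DifferentiableOn.mul (by fun_prop) ?_
    rw [Complex.differentiableOn_dslope h2, Complex.differentiableOn_dslope h1]
    exact ih.sub (by fun_prop)

theorem sub_mul_twoPointRem_succ {p : ℂ} (hp : p ≠ 0) (F : ℂ → ℂ) (j : ℕ) (w : ℂ) :
    (w ^ 2 - p ^ 2) * twoPointRem p F (j + 1) w =
      w ^ 2 * (twoPointRem p F j w - (twoPointA p F j + w * twoPointB p F j)) := by
  set h : ℂ → ℂ := fun v => twoPointRem p F j v - (twoPointA p F j + v * twoPointB p F j) with hh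
  have hp1 : h p = 0 := by
    simp only [hh, twoPointA, twoPointB, interpA, interpB]
    field_simp
    ring
  have hp2 : h (-p) = 0 := by
    simp only [hh, twoPointA, twoPointB, interpA, interpB]
    field_simp
    ring
  have h1 : ∀ v, (v - p) * dslope h p v = h v := fun v => by
    simpa [hp1] using sub_smul_dslope h p v
  have h2 : dslope h p (-p) = 0 := by
    have := h1 (-p)
    rw [hp2, mul_eq_zero] at this
    refine this.resolve_left fun h0 => hp ?_
    linear_combination (-1 / 2 : ℂ) * h0
  have h3 : (w + p) * dslope (dslope h p) (-p) w = dslope h p w := by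
    simpa [h2] using sub_smul_dslope (dslope h p) (-p) w
  change (w ^ 2 - p ^ 2) * (w ^ 2 * dslope (dslope h p) (-p) w) = w ^ 2 * h w
  rw [← h1 w, ← h3]
  ring

/-- The solution `w` of `(w² - p²) / w² = u` that tends to `p` as `u → 0`. -/
def branchPoint (p u : ℂ) : ℂ := p * (1 - u) ^ (-(1 / 2) : ℂ)

/-- The part `A` of `F(w) = A(u) + w B(u)`, where `u = (w² - p²) / w²`. -/
def branchA (p : ℂ) (F : ℂ → ℂ) (u : ℂ) : ℂ := (F (branchPoint p u) + F (-branchPoint p u)) / 2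

/-- The part `B` of `F(w) = A(u) + w B(u)`, where `u = (w² - p²) / w²`. -/
def branchB (p : ℂ) (F : ℂ → ℂ) (u : ℂ) : ℂ :=
  (F (branchPoint p u) - F (-branchPoint p u)) / (2 * branchPoint p u)

theorem branchPoint_zero (p : ℂ) : branchPoint p 0 = p := by simp [branchPoint]

theorem branchPoint_sq_mul (p : ℂ) {u : ℂ} (hu : 1 - u ≠ 0) :
    branchPoint p u ^ 2 * (1 - u) = p ^ 2 := by
  rw [branchPoint, mul_pow, ← Complex.cpow_nat_mul]
  norm_num [Complex.cpow_neg_one, hu]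

theorem branchPoint_ne_zero {p : ℂ} (hp : p ≠ 0) {u : ℂ} (hu : 1 - u ≠ 0) :
    branchPoint p u ≠ 0 := by
  intro h
  have := branchPoint_sq_mul p hu
  rw [h] at this
  simp at this
  exact hp (by simpa using this.symm)

theorem analyticAt_branchPoint (p : ℂ) : AnalyticAt ℂ (branchPoint p) 0 := by
  unfold branchPoint
  refine analyticAt_const.mul (AnalyticAt.cpow (by fun_prop) analyticAt_const ?_)
  simp

theorem analyticAt_branchA {p : ℂ} {F : ℂ → ℂ} (h1 : AnalyticAt ℂ F p) (h2 : AnalyticAt ℂ F (-p)) :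
    AnalyticAt ℂ (branchA p F) 0 := by
  have hb := analyticAt_branchPoint p
  have e1 : AnalyticAt ℂ (fun u => F (branchPoint p u)) 0 :=
    AnalyticAt.fun_comp (by rwa [branchPoint_zero]) hb
  have e2 : AnalyticAt ℂ (fun u => F (-branchPoint p u)) 0 :=
    AnalyticAt.fun_comp (by rwa [branchPoint_zero]) hb.neg
  exact (e1.add e2).div analyticAt_const two_ne_zero

theorem analyticAt_branchB {p : ℂ} (hp : p ≠ 0) {F : ℂ → ℂ} (h1 : AnalyticAt ℂ F p)
    (h2 : AnalyticAt ℂ F (-p)) : AnalyticAt ℂ (branchB p F) 0 := by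
  have hb := analyticAt_branchPoint p
  have e1 : AnalyticAt ℂ (fun u => F (branchPoint p u)) 0 :=
    AnalyticAt.fun_comp (by rwa [branchPoint_zero]) hb
  have e2 : AnalyticAt ℂ (fun u => F (-branchPoint p u)) 0 :=
    AnalyticAt.fun_comp (by rwa [branchPoint_zero]) hb.neg
  exact (e1.sub e2).div (analyticAt_const.mul hb) (by simp [branchPoint_zero, hp])

theorem eventually_one_sub_ne_zero : ∀ᶠ u : ℂ in 𝓝 0, 1 - u ≠ 0 :=
  ContinuousAt.eventually_ne (by fun_prop) (by simp)

theorem taylorCoeff_zero (F : ℂ → ℂ) : taylorCoeff F 0 = F 0 := by simp [taylorCoeff]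

theorem taylorCoeff_succ_of_mul_eq {G H : ℂ → ℂ} {a : ℂ} (hH : AnalyticAt ℂ H 0)
    (h : ∀ᶠ u in 𝓝 (0 : ℂ), G u = a + u * H u) (n : ℕ) :
    taylorCoeff G (n + 1) = taylorCoeff H n := by
  rw [taylorCoeff_congr h, taylorCoeff_add (G := fun w => w * H w) analyticAt_const (analyticAt_id.mul hH)]
  have h1 : taylorCoeff (fun _ => a) (n + 1) = 0 := by simp [taylorCoeff, iteratedDeriv_const]
  have h2 := taylorCoeff_id_mul hH (n + 1)
  rw [if_neg (by omega), Nat.add_sub_cancel] at h2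
  rw [h1, zero_add]
  exact h2

section

variable {p : ℂ} (hp : p ≠ 0) {F : ℂ → ℂ} {R : ℝ} (hpR : ‖p‖ < R)
  (hF : DifferentiableOn ℂ F (Metric.ball 0 R))

include hp hpR hF

theorem twoPoint_eq_taylorCoeff_branch (j n : ℕ) :
    taylorCoeff (branchA p (twoPointRem p F j)) n = taylorCoeff (branchA p F) (n + j) ∧
    taylorCoeff (branchB p (twoPointRem p F j)) n = taylorCoeff (branchB p F) (n + j) := by
  induction j generalizing n with
  | zero => exact ⟨rfl, rfl⟩
  | succ j ih =>
    have h1 : Metric.ball (0 : ℂ) R ∈ 𝓝 p := Metric.isOpen_ball.mem_nhds (by simpa using hpR)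
    have h2 : Metric.ball (0 : ℂ) R ∈ 𝓝 (-p) := Metric.isOpen_ball.mem_nhds (by simpa using hpR)
    have hd := differentiableOn_twoPointRem hpR hF (j + 1)
    have key : ∀ u : ℂ, 1 - u ≠ 0 → ∀ w : ℂ, w ≠ 0 → w ^ 2 * (1 - u) = p ^ 2 →
        u * twoPointRem p F (j + 1) w =
          twoPointRem p F j w - (twoPointA p F j + w * twoPointB p F j) := by
      intro u hu w hw hwu
      have := sub_mul_twoPointRem_succ hp F j w
      refine mul_left_cancel₀ (pow_ne_zero 2 hw) ?_
      rw [← this, ← hwu]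
      ring
    rw [show n + (j + 1) = n + 1 + j by ring, ← (ih (n + 1)).1, ← (ih (n + 1)).2]
    constructor
    · symm
      refine taylorCoeff_succ_of_mul_eq (a := twoPointA p F j)
        (analyticAt_branchA (hd.analyticAt h1) (hd.analyticAt h2)) ?_ n
      filter_upwards [eventually_one_sub_ne_zero] with u hu
      have hb := branchPoint_ne_zero hp hu
      have k1 := key u hu _ hb (branchPoint_sq_mul p hu)
      have k2 := key u hu _ (neg_ne_zero.2 hb) (by rw [neg_sq]; exact branchPoint_sq_mul p hu)
      simp only [branchA]
      linear_combination (-1 / 2 : ℂ) * k1 + (-1 / 2 : ℂ) * k2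
    · symm
      refine taylorCoeff_succ_of_mul_eq (a := twoPointB p F j)
        (analyticAt_branchB hp (hd.analyticAt h1) (hd.analyticAt h2)) ?_ n
      filter_upwards [eventually_one_sub_ne_zero] with u hu
      have hb := branchPoint_ne_zero hp hu
      have k1 := key u hu _ hb (branchPoint_sq_mul p hu)
      have k2 := key u hu _ (neg_ne_zero.2 hb) (by rw [neg_sq]; exact branchPoint_sq_mul p hu)
      simp only [branchB]
      field_simp
      linear_combination -k1 + k2

theorem twoPointA_eq_taylorCoeff (k : ℕ) : twoPointA p F k = taylorCoeff (branchA p F) k := by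
  have := (twoPoint_eq_taylorCoeff_branch hp hpR hF k 0).1
  rw [zero_add, taylorCoeff_zero] at this
  rw [← this]
  simp [branchA, branchPoint_zero, twoPointA, interpA]

theorem twoPointB_eq_taylorCoeff (k : ℕ) : twoPointB p F k = taylorCoeff (branchB p F) k := by
  have := (twoPoint_eq_taylorCoeff_branch hp hpR hF k 0).2
  rw [zero_add, taylorCoeff_zero] at this
  rw [← this]
  simp [branchB, branchPoint_zero, twoPointB, interpB]

theorem eventually_hasSum_twoPoint :
    ∀ᶠ w in 𝓝 p ⊔ 𝓝 (-p), HasSum (fun k : ℕ => (twoPointA p F k + w * twoPointB p F k) *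
      ((w ^ 2 - p ^ 2) / w ^ 2) ^ k) (F w) := by
  have h1 : Metric.ball (0 : ℂ) R ∈ 𝓝 p := Metric.isOpen_ball.mem_nhds (by simpa using hpR)
  have h2 : Metric.ball (0 : ℂ) R ∈ 𝓝 (-p) := Metric.isOpen_ball.mem_nhds (by simpa using hpR)
  have hA := eventually_hasSum_taylorCoeff (analyticAt_branchA (hF.analyticAt h1) (hF.analyticAt h2))
  have hB := eventually_hasSum_taylorCoeff
    (analyticAt_branchB hp (hF.analyticAt h1) (hF.analyticAt h2))
  have hu : ∀ q : ℂ, q ^ 2 = p ^ 2 → q ≠ 0 → ∀ᶠ w in 𝓝 q,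
      HasSum (fun k : ℕ => (twoPointA p F k + w * twoPointB p F k) *
      ((w ^ 2 - p ^ 2) / w ^ 2) ^ k) (F w) := by
    intro q hq hq0
    have ht : Tendsto (fun w : ℂ => (w ^ 2 - p ^ 2) / w ^ 2) (𝓝 q) (𝓝 0) := by
      have : ContinuousAt (fun w : ℂ => (w ^ 2 - p ^ 2) / w ^ 2) q :=
        ContinuousAt.div (by fun_prop) (by fun_prop) (pow_ne_zero 2 hq0)
      simpa [ContinuousAt, hq] using this
    filter_upwards [ht.eventually hA, ht.eventually hB, eventually_ne_nhds hq0,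
      ht.eventually eventually_one_sub_ne_zero] with w wA wB hw hw1
    have hb := branchPoint_ne_zero hp hw1
    have hs := branchPoint_sq_mul p hw1
    have hs' : branchPoint p ((w ^ 2 - p ^ 2) / w ^ 2) ^ 2 = w ^ 2 := by
      refine mul_right_cancel₀ hw1 ?_
      rw [hs]
      field_simp
      ring
    have hFw : F w = branchA p F ((w ^ 2 - p ^ 2) / w ^ 2) +
        w * branchB p F ((w ^ 2 - p ^ 2) / w ^ 2) := by
      rcases sq_eq_sq_iff_eq_or_eq_neg.1 hs' with h | h
      · simp only [branchA, branchB, h]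
        field_simp
        ring
      · simp only [branchA, branchB, h, neg_neg]
        field_simp
        ring
    rw [hFw]
    refine (wA.add (wB.mul_left w)).congr_fun fun k => ?_
    rw [twoPointA_eq_taylorCoeff hp hpR hF, twoPointB_eq_taylorCoeff hp hpR hF]
    ring
  exact eventually_sup.2 ⟨hu p rfl hp, hu (-p) (neg_sq p) (neg_ne_zero.2 hp)⟩

theorem twoPoint_unique {a b : ℕ → ℂ}
    (h : ∀ᶠ w in 𝓝 p ⊔ 𝓝 (-p), HasSum (fun k : ℕ => (a k + w * b k) *
      ((w ^ 2 - p ^ 2) / w ^ 2) ^ k) (F w)) :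
    a = twoPointA p F ∧ b = twoPointB p F := by
  obtain ⟨h1, h2⟩ := eventually_sup.1 h
  have ht : Tendsto (branchPoint p) (𝓝 0) (𝓝 p) := by
    simpa [ContinuousAt, branchPoint_zero] using (analyticAt_branchPoint p).continuousAt
  have key : ∀ᶠ u in 𝓝 (0 : ℂ), branchPoint p u ≠ 0 ∧
      HasSum (fun k => (a k + branchPoint p u * b k) * u ^ k) (F (branchPoint p u)) ∧
      HasSum (fun k => (a k - branchPoint p u * b k) * u ^ k) (F (-branchPoint p u)) := by
    filter_upwards [eventually_one_sub_ne_zero, ht.eventually h1, ht.neg.eventually h2]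
      with u hu e1 e2
    have hb := branchPoint_ne_zero hp hu
    have hs : (branchPoint p u ^ 2 - p ^ 2) / branchPoint p u ^ 2 = u := by
      rw [← branchPoint_sq_mul p hu]
      field_simp
      ring
    rw [hs] at e1
    rw [neg_sq, hs] at e2
    exact ⟨hb, e1, by simpa [sub_eq_add_neg] using e2⟩
  constructor
  · ext k
    rw [twoPointA_eq_taylorCoeff hp hpR hF]
    refine (taylorCoeff_eq_of_hasSum ?_ k).symm
    filter_upwards [key] with u ⟨_, e1, e2⟩
    refine ((e1.add e2).div_const 2).congr_fun fun k => ?_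
    ring
  · ext k
    rw [twoPointB_eq_taylorCoeff hp hpR hF]
    refine (taylorCoeff_eq_of_hasSum ?_ k).symm
    filter_upwards [key] with u ⟨hb, e1, e2⟩
    refine ((e1.sub e2).div_const (2 * branchPoint p u)).congr_fun fun k => ?_
    field_simp
    ring

end

/-- The function `r^{-2n} (-1)^{n+k} (μ-k)_{n+k} / (n+k)!`. -/
def expansionTerm (r : ℝ) (μ : ℂ) (k n : ℕ) : ℂ :=
  (-1) ^ (n + k) * (ascPochhammer ℂ (n + k)).eval (μ - k) / ((n + k)! : ℂ) / (r : ℂ) ^ (2 * n)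

theorem taylorCoeff_binomFactor_sub (r : ℝ) (μ : ℂ) (k n : ℕ) (hr : r ≠ 0) :
    (r : ℂ) ^ (2 * k) * taylorCoeff (binomFactor r (k - μ)) (2 * (n + k)) =
      expansionTerm r μ k n := by
  have hr' : (r : ℂ) ≠ 0 := by exact_mod_cast hr
  rw [(taylorCoeff_binomFactor_even r _ _).1, show (k : ℂ) - μ = -(μ - k) by ring,
    ringChoose_eq_ascPochhammer, expansionTerm, mul_add, pow_add (r : ℂ)]
  field_simp

section

variable {F : ℂ → ℂ} {r R : ℝ} (hr : 0 < r) (hrR : r < R)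
  (hF : DifferentiableOn ℂ F (Metric.ball 0 R))

include hr hrR hF

theorem taylorCoeff_twoPointRem_mul (ν : ℂ) (j m : ℕ) :
    taylorCoeff (fun w => twoPointRem (r * Complex.I) F j w * binomFactor r ν w) m =
      twoPointA (r * Complex.I) F j * taylorCoeff (binomFactor r ν) m +
      twoPointB (r * Complex.I) F j * taylorCoeff (fun w => w * binomFactor r ν w) m +
      (r : ℂ) ^ 2 * taylorCoeff
        (fun w => twoPointRem (r * Complex.I) F (j + 1) w * binomFactor r (ν + 1) w) (m + 2) := by
  set p : ℂ := r * Complex.I with hp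
  have hr' : (r : ℂ) ≠ 0 := by exact_mod_cast hr.ne'
  have hp0 : p ≠ 0 := mul_ne_zero hr' Complex.I_ne_zero
  have hpR : ‖p‖ < R := by simpa [hp, abs_of_pos hr] using hrR
  have hp2 : p ^ 2 = -(r : ℂ) ^ 2 := by rw [hp, mul_pow, Complex.I_sq]; ring
  have h0 : Metric.ball (0 : ℂ) R ∈ 𝓝 0 := Metric.ball_mem_nhds _ (hr.trans hrR)
  have hj : AnalyticAt ℂ (twoPointRem p F j) 0 :=
    (differentiableOn_twoPointRem hpR hF j).analyticAt h0
  have hj1 : AnalyticAt ℂ (twoPointRem p F (j + 1)) 0 :=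
    (differentiableOn_twoPointRem hpR hF (j + 1)).analyticAt h0
  have hb := analyticAt_binomFactor r ν
  have hb1 := analyticAt_binomFactor r (ν + 1)
  have hwb : AnalyticAt ℂ (fun w => w * binomFactor r ν w) 0 := analyticAt_id.mul hb
  have e1 : AnalyticAt ℂ (fun w => twoPointA p F j * binomFactor r ν w) 0 :=
    analyticAt_const.mul hb
  have e2 : AnalyticAt ℂ (fun w => twoPointB p F j * (w * binomFactor r ν w)) 0 :=
    analyticAt_const.mul hwb
  have e12 : AnalyticAt ℂ (fun w => twoPointA p F j * binomFactor r ν w +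
    twoPointB p F j * (w * binomFactor r ν w)) 0 := e1.add e2
  have e3 : AnalyticAt ℂ
      (fun w => twoPointRem p F (j + 1) w * binomFactor r (ν + 1) w) 0 := hj1.mul hb1
  have e4 : AnalyticAt ℂ
      (fun w => (r : ℂ) ^ 2 * (twoPointRem p F (j + 1) w * binomFactor r (ν + 1) w)) 0 :=
    analyticAt_const.mul e3
  have e5 : AnalyticAt ℂ (fun w => w ^ 2 * (twoPointA p F j * binomFactor r ν w +
      twoPointB p F j * (w * binomFactor r ν w))) 0 := (analyticAt_id.pow 2).mul e12
  have key : (fun w => w ^ 2 * (twoPointRem p F j w * binomFactor r ν w)) =ᶠ[𝓝 0]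
      fun w => w ^ 2 * (twoPointA p F j * binomFactor r ν w +
        twoPointB p F j * (w * binomFactor r ν w)) +
        (r : ℂ) ^ 2 * (twoPointRem p F (j + 1) w * binomFactor r (ν + 1) w) := by
    filter_upwards [binomFactor_add_one r ν] with w hw
    have := sub_mul_twoPointRem_succ hp0 F j w
    rw [hp2] at this
    rw [hw]
    field_simp
    linear_combination (-binomFactor r ν w) * this
  have hmul : AnalyticAt ℂ (fun w => twoPointRem p F j w * binomFactor r ν w) 0 := hj.mul hb
  rw [← taylorCoeff_sq_mul hmul, taylorCoeff_congr key, taylorCoeff_add e5 e4,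
    taylorCoeff_sq_mul e12, taylorCoeff_add e1 e2, taylorCoeff_const_mul, taylorCoeff_const_mul,
    taylorCoeff_const_mul]

theorem taylorCoeff_mul_binomFactor_even (μ : ℂ) (n N : ℕ) :
    taylorCoeff (fun w => F w * binomFactor r (-μ) w) (2 * n) =
      ∑ k ∈ Finset.range N, twoPointA (r * Complex.I) F k * expansionTerm r μ k n +
      (r : ℂ) ^ (2 * N) * taylorCoeff
        (fun w => twoPointRem (r * Complex.I) F N w * binomFactor r (N - μ) w) (2 * (n + N)) := by
  induction N with
  | zero => simp [twoPointRem]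
  | succ N ih =>
    have h1 : taylorCoeff (fun w => w * binomFactor r (N - μ) w) (2 * (n + N)) = 0 := by
      rw [taylorCoeff_id_mul (analyticAt_binomFactor _ _)]
      split_ifs with h
      · rfl
      · rw [show 2 * (n + N) - 1 = 2 * (n + N - 1) + 1 by omega,
          (taylorCoeff_binomFactor_even _ _ _).2]
    rw [ih, taylorCoeff_twoPointRem_mul hr hrR hF, Finset.sum_range_succ,
      ← taylorCoeff_binomFactor_sub r μ N n hr.ne', h1,
      show (N : ℂ) - μ + 1 = ((N + 1 : ℕ) : ℂ) - μ by push_cast; ring,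
      show 2 * (n + N) + 2 = 2 * (n + (N + 1)) by ring]
    ring

theorem taylorCoeff_mul_binomFactor_odd (μ : ℂ) (n N : ℕ) :
    taylorCoeff (fun w => F w * binomFactor r (-μ) w) (2 * n + 1) =
      ∑ k ∈ Finset.range N, twoPointB (r * Complex.I) F k * expansionTerm r μ k n +
      (r : ℂ) ^ (2 * N) * taylorCoeff
        (fun w => twoPointRem (r * Complex.I) F N w * binomFactor r (N - μ) w)
        (2 * (n + N) + 1) := by
  induction N with
  | zero => simp [twoPointRem]
  | succ N ih =>
    have h1 : taylorCoeff (fun w => w * binomFactor r (N - μ) w) (2 * (n + N) + 1) =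
        taylorCoeff (binomFactor r (N - μ)) (2 * (n + N)) := by
      rw [taylorCoeff_id_mul (analyticAt_binomFactor _ _), if_neg (by omega), Nat.add_sub_cancel]
    rw [ih, taylorCoeff_twoPointRem_mul hr hrR hF, Finset.sum_range_succ,
      ← taylorCoeff_binomFactor_sub r μ N n hr.ne', h1, (taylorCoeff_binomFactor_even _ _ _).2,
      show (N : ℂ) - μ + 1 = ((N + 1 : ℕ) : ℂ) - μ by push_cast; ring,
      show 2 * (n + N) + 1 + 2 = 2 * (n + (N + 1)) + 1 by ring]
    ring

theorem isBigO_taylorCoeff_twoPointRem (μ : ℂ) (N ε : ℕ) :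
    (fun n : ℕ => (r : ℂ) ^ (2 * N) * taylorCoeff
        (fun w => twoPointRem (r * Complex.I) F N w * binomFactor r (N - μ) w)
        (2 * (n + N) + ε)) =O[atTop]
      fun n : ℕ => (n : ℂ) ^ (μ - N - 1) / (r : ℂ) ^ (2 * n) := by
  have hpR : ‖(r : ℂ) * Complex.I‖ < R := by simpa [abs_of_pos hr] using hrR
  obtain ⟨K, hK⟩ := exists_norm_taylorCoeff_mul_binomFactor_le hr hrR
    (differentiableOn_twoPointRem hpR hF N) (N - μ)
  have hK0 : 0 ≤ K := by simpa using (norm_nonneg _).trans (hK 0)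
  set t : ℝ := 2 * N + ε + 3 with ht
  have he : -((N : ℂ) - μ).re - 1 = (μ - N - 1).re := by simp
  refine IsBigO.of_bound (K * t ^ |(μ - N - 1).re| / r ^ ε) ?_
  filter_upwards [eventually_ge_atTop 1] with n hn
  have hn' : (1 : ℝ) ≤ n := by exact_mod_cast hn
  have hN : (0 : ℝ) ≤ N := N.cast_nonneg
  have hε : (0 : ℝ) ≤ ε := ε.cast_nonneg
  have h1 : (((2 * (n + N) + ε : ℕ) : ℝ) + 1) ^ (μ - N - 1).re ≤
      t ^ |(μ - N - 1).re| * (n : ℝ) ^ (μ - N - 1).re := by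
    refine rpow_le_rpow_abs_mul (by positivity) (by linarith) (by linarith) ?_ ?_ _
    · push_cast; nlinarith
    · push_cast; nlinarith
  have h2 := hK (2 * (n + N) + ε)
  rw [he] at h2
  rw [norm_mul, norm_div, norm_pow, norm_pow, Complex.norm_real, Real.norm_of_nonneg hr.le,
    Complex.norm_natCast_cpow_of_pos hn]
  calc r ^ (2 * N) * ‖_‖ ≤ r ^ (2 * N) * (K * (t ^ |(μ - N - 1).re| * (n : ℝ) ^ (μ - N - 1).re) /
        r ^ (2 * (n + N) + ε)) := by
        refine mul_le_mul_of_nonneg_left (h2.trans ?_) (by positivity)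
        gcongr
    _ = _ := by
        rw [pow_add, mul_add, pow_add]
        field_simp

end

theorem isLittleO_scale (μ : ℂ) (c : ℕ → ℂ) (k : ℕ) :
    (fun n : ℕ => c n * (n : ℂ) ^ (μ - (k + 1 : ℕ) - 1)) =o[atTop]
      fun n : ℕ => c n * (n : ℂ) ^ (μ - k - 1) := by
  have h1 : (fun n : ℕ => ((n : ℂ))⁻¹) =o[atTop] fun _ => (1 : ℂ) := by
    rw [isLittleO_one_iff]
    exact tendsto_inv_atTop_nhds_zero_nat
  have h2 := h1.mul_isBigO (isBigO_refl (fun n : ℕ => c n * (n : ℂ) ^ (μ - k - 1)) atTop)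
  refine h2.congr' ?_ (by simp)
  filter_upwards [eventually_ge_atTop 1] with n hn
  have hn' : (n : ℂ) ≠ 0 := by exact_mod_cast (by omega : n ≠ 0)
  rw [show μ - (k + 1 : ℕ) - 1 = (μ - k - 1) - 1 by push_cast; ring,
    Complex.cpow_sub (μ - k - 1) 1 hn', Complex.cpow_one, div_eq_mul_inv]
  ring

theorem hasAsympExpansion_of_taylorCoeff {G : ℂ → ℂ} {r : ℝ} {μ c : ℂ} {a : ℕ → ℂ}
    {t : ℕ → ℕ → ℂ} {ix : ℕ → ℕ} (ht : ∀ k n, t k n = (ix n)! * c * expansionTerm r μ k n)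
    (h : ∀ N, (fun n : ℕ => taylorCoeff G (ix n) -
      c * ∑ k ∈ Finset.range N, a k * expansionTerm r μ k n) =O[atTop]
      fun n : ℕ => (n : ℂ) ^ (μ - N - 1) / (r : ℂ) ^ (2 * n)) :
    HasAsympExpansion (fun n => iteratedDeriv (ix n) G 0) a t
      (fun k n => ((ix n)! : ℂ) / (r : ℂ) ^ (2 * n) * (n : ℂ) ^ (μ - k - 1)) := by
  refine ⟨isLittleO_scale μ _, fun N => ?_⟩
  refine ((isBigO_refl (fun n : ℕ => ((ix n)! : ℂ)) atTop).mul (h N)).congr (fun n => ?_)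
    (fun n => by ring)
  dsimp only
  rw [iteratedDeriv_eq_taylorCoeff, mul_sub, Finset.mul_sum, Finset.mul_sum]
  congr 1
  refine Finset.sum_congr rfl fun k _ => ?_
  rw [ht]
  ring

section

variable {F G : ℂ → ℂ} {r R : ℝ} (hr : 0 < r) (hrR : r < R) {μ c : ℂ}
  (hF : DifferentiableOn ℂ F (Metric.ball 0 R))
  (hG : G =ᶠ[𝓝 0] fun w => c * (F w * binomFactor r (-μ) w)) {t : ℕ → ℕ → ℂ}

include hr hrR hF hG

theorem hasAsympExpansion_even
    (ht : ∀ k n, t k n = (2 * n)! * c * expansionTerm r μ k n) :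
    HasAsympExpansion (fun n => iteratedDeriv (2 * n) G 0) (twoPointA (r * Complex.I) F) t
      (fun k n => ((2 * n)! : ℂ) / (r : ℂ) ^ (2 * n) * (n : ℂ) ^ (μ - k - 1)) := by
  refine hasAsympExpansion_of_taylorCoeff ht fun N => ?_
  refine ((isBigO_taylorCoeff_twoPointRem hr hrR hF μ N 0).const_mul_left c).congr_left
    fun n => ?_
  rw [taylorCoeff_congr hG, taylorCoeff_const_mul, taylorCoeff_mul_binomFactor_even hr hrR hF μ n N]
  ring_nf

theorem hasAsympExpansion_odd
    (ht : ∀ k n, t k n = (2 * n + 1)! * c * expansionTerm r μ k n) :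
    HasAsympExpansion (fun n => iteratedDeriv (2 * n + 1) G 0) (twoPointB (r * Complex.I) F) t
      (fun k n => ((2 * n + 1)! : ℂ) / (r : ℂ) ^ (2 * n) * (n : ℂ) ^ (μ - k - 1)) := by
  refine hasAsympExpansion_of_taylorCoeff (ix := fun n => 2 * n + 1) ht fun N => ?_
  refine ((isBigO_taylorCoeff_twoPointRem hr hrR hF μ N 1).const_mul_left c).congr_left
    fun n => ?_
  rw [taylorCoeff_congr hG, taylorCoeff_const_mul, taylorCoeff_mul_binomFactor_odd hr hrR hF μ n N]
  ring_nf

end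

theorem HasAsympExpansion.of_isTheta {u a : ℕ → ℂ} {t s : ℕ → ℕ → ℂ}
    (h : HasAsympExpansion u a t s) (hts : ∀ k, t k =Θ[atTop] s k) : HasAsympExpansion u a t t :=
  ⟨fun k => ((hts (k + 1)).trans_isLittleO (h.1 k)).trans_isTheta (hts k).symm,
    fun N => (h.2 N).trans_isTheta (hts N).symm⟩

theorem isTheta_natCast_add_cpow (a : ℂ) (k : ℕ) :
    (fun n : ℕ => ((n + k : ℕ) : ℂ) ^ a) =Θ[atTop] fun n : ℕ => (n : ℂ) ^ a := by
  have hk : (0 : ℝ) ≤ k := k.cast_nonneg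
  constructor
  · refine IsBigO.of_bound (((k : ℝ) + 1) ^ |a.re|) ?_
    filter_upwards [eventually_ge_atTop 1] with n hn
    have hn' : (1 : ℝ) ≤ n := by exact_mod_cast hn
    rw [Complex.norm_natCast_cpow_of_pos hn, Complex.norm_natCast_cpow_of_pos (by omega)]
    refine rpow_le_rpow_abs_mul (by positivity) (by linarith) (by linarith) ?_ ?_ _ <;>
    · push_cast; nlinarith
  · refine IsBigO.of_bound (((k : ℝ) + 1) ^ |a.re|) ?_
    filter_upwards [eventually_ge_atTop 1] with n hn
    have hn' : (1 : ℝ) ≤ n := by exact_mod_cast hn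
    rw [Complex.norm_natCast_cpow_of_pos hn, Complex.norm_natCast_cpow_of_pos (by omega)]
    refine rpow_le_rpow_abs_mul (by linarith) (by positivity) (by linarith) ?_ ?_ _ <;>
    · push_cast; nlinarith

theorem isTheta_expansionTerm {μ : ℂ} (hμ : ∀ m : ℤ, μ ≠ m) {r : ℝ} (k : ℕ) :
    expansionTerm r μ k =Θ[atTop] fun n : ℕ => (n : ℂ) ^ (μ - k - 1) / (r : ℂ) ^ (2 * n) := by
  have h1 : ∀ m : ℕ, μ - k ≠ -m := fun m h => hμ (k - m) (by
    push_cast; linear_combination h)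
  have h0 := isTheta_ascPochhammer h1
  have h2 := IsTheta.trans ⟨h0.1.comp_tendsto (tendsto_add_atTop_nat k),
    h0.2.comp_tendsto (tendsto_add_atTop_nat k)⟩ (isTheta_natCast_add_cpow (μ - k - 1) k)
  have h3 := h2.div (isTheta_refl (fun n : ℕ => (r : ℂ) ^ (2 * n)) atTop)
  refine IsTheta.trans ?_ h3
  refine IsTheta.of_norm_eventuallyEq_norm (Eventually.of_forall fun n => ?_)
  simp [expansionTerm]

theorem isTheta_scale {μ c : ℂ} (hc : c ≠ 0) (hμ : ∀ m : ℤ, μ ≠ m) {r : ℝ} {ix : ℕ → ℕ}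
    {t : ℕ → ℕ → ℂ} (ht : ∀ k n, t k n = (ix n)! * c * expansionTerm r μ k n) (k : ℕ) :
    t k =Θ[atTop] fun n : ℕ => ((ix n)! : ℂ) / (r : ℂ) ^ (2 * n) * (n : ℂ) ^ (μ - k - 1) := by
  have h := (isTheta_refl (fun n : ℕ => ((ix n)! : ℂ)) atTop).mul
    ((isTheta_expansionTerm hμ (r := r) k).const_mul_left hc)
  have e1 : t k = fun n : ℕ => ((ix n)! : ℂ) * (c * expansionTerm r μ k n) := by
    ext n; rw [ht]; ring
  have e2 : (fun n : ℕ => ((ix n)! : ℂ) / (r : ℂ) ^ (2 * n) * (n : ℂ) ^ (μ - k - 1)) =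
      fun n : ℕ => ((ix n)! : ℂ) * ((n : ℂ) ^ (μ - k - 1) / (r : ℂ) ^ (2 * n)) := by
    ext n; ring
  rw [e1, e2]
  exact h

theorem exists_tendsto_mul_deriv_div {u : ℂ → ℂ} {a : ℂ} (hu : AnalyticAt ℂ u a)
    (h0 : ¬ ∀ᶠ w in 𝓝 a, u w = 0) :
    ∃ e : ℕ, Tendsto (fun w => (w - a) * deriv u w / u w) (𝓝[≠] a) (𝓝 e) := by
  obtain ⟨e, U, hU, hU0, h⟩ := hu.exists_eventuallyEq_pow_smul_nonzero_iff.2 h0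
  refine ⟨e, ?_⟩
  have h1 : Tendsto (fun w => (e : ℂ) + (w - a) * deriv U w / U w) (𝓝[≠] a) (𝓝 e) := by
    have : ContinuousAt (fun w => (e : ℂ) + (w - a) * deriv U w / U w) a :=
      continuousAt_const.add (((continuousAt_id.sub continuousAt_const).mul
        hU.deriv.continuousAt).div hU.continuousAt hU0)
    have h2 := this.tendsto.mono_left (nhdsWithin_le_nhds (s := {a}ᶜ))
    simpa using h2
  refine h1.congr' ?_
  have hd : deriv u =ᶠ[𝓝 a] deriv fun w => (w - a) ^ e • U w := EventuallyEq.deriv h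
  filter_upwards [nhdsWithin_le_nhds h, nhdsWithin_le_nhds hd,
    nhdsWithin_le_nhds (hU.continuousAt.eventually_ne hU0), self_mem_nhdsWithin,
    nhdsWithin_le_nhds hU.eventually_analyticAt] with w e1 e2 e3 e4 e5
  have e4' : w - a ≠ 0 := sub_ne_zero.2 e4
  have e6 : HasDerivAt (fun w => (w - a) ^ e • U w)
      ((e : ℂ) * (w - a) ^ (e - 1) * U w + (w - a) ^ e * deriv U w) w := by
    have := (((hasDerivAt_id w).sub_const a).pow e).mul e5.differentiableAt.hasDerivAt
    simpa using! this
  rw [e1, e2, e6.deriv, smul_eq_mul]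
  rcases Nat.eq_zero_or_pos e with rfl | he
  · field_simp
    simp
  · obtain ⟨m, rfl⟩ := Nat.exists_eq_succ_of_ne_zero he.ne'
    rw [Nat.succ_sub_one, pow_succ]
    field_simp

theorem exists_int_eq_of_ode {u C D : ℂ → ℂ} {a μ : ℂ} (hu : AnalyticAt ℂ u a)
    (hC : AnalyticAt ℂ C a) (hD : AnalyticAt ℂ D a) (hu0 : ¬ ∀ᶠ w in 𝓝 a, u w = 0)
    (hC0 : ¬ ∀ᶠ w in 𝓝 a, C w = 0) (hDa : D a = 0) (hD' : deriv D a ≠ 0)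
    (h : ∀ᶠ w in 𝓝 a, deriv u w * D w * C w =
      u w * (-μ * deriv D w * C w + D w * deriv C w)) : ∃ m : ℤ, μ = m := by
  obtain ⟨e, he⟩ := exists_tendsto_mul_deriv_div hu hu0
  obtain ⟨v, hv⟩ := exists_tendsto_mul_deriv_div hC hC0
  have h1 : Tendsto (fun w => (w - a) * deriv D w / D w) (𝓝[≠] a) (𝓝 1) := by
    have s1 := hasDerivAt_iff_tendsto_slope.1 hD.differentiableAt.hasDerivAt
    have s2 := (hD.deriv.continuousAt.tendsto.mono_left
      (nhdsWithin_le_nhds (s := {a}ᶜ))).div s1 hD'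
    rw [div_self hD'] at s2
    refine s2.congr' ?_
    filter_upwards [self_mem_nhdsWithin] with w hw
    have hw' : w - a ≠ 0 := sub_ne_zero.2 hw
    rw [Pi.div_apply, slope_def_field, hDa, sub_zero]
    field_simp
  have hD0 : ¬ ∀ᶠ w in 𝓝 a, D w = 0 := fun h0 => hD' (by
    have : D =ᶠ[𝓝 a] fun _ => 0 := h0
    rw [this.deriv_eq, deriv_const])
  have n1 := hu.eventually_eq_zero_or_eventually_ne_zero.resolve_left hu0
  have n2 := hC.eventually_eq_zero_or_eventually_ne_zero.resolve_left hC0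
  have n3 := hD.eventually_eq_zero_or_eventually_ne_zero.resolve_left hD0
  have h2 : Tendsto (fun w => (w - a) * deriv u w / u w) (𝓝[≠] a) (𝓝 (-μ * 1 + v)) := by
    refine ((h1.const_mul (-μ)).add hv).congr' ?_
    filter_upwards [n1, n2, n3, nhdsWithin_le_nhds h] with w w1 w2 w3 w4
    field_simp
    linear_combination (-(w - a)) * w4
  have h3 := tendsto_nhds_unique he h2
  refine ⟨(v : ℤ) - e, ?_⟩
  push_cast
  linear_combination h3

theorem differentiableOn_tsum_mul_pow {γ : ℕ → ℂ}
    (hγ : ∀ ρ : ℝ, 0 < ρ → ρ < 1 → Summable fun k => ‖γ k‖ * ρ ^ k) :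
    DifferentiableOn ℂ (fun v => ∑' k, γ k * v ^ k) (Metric.ball 0 1) := by
  intro v hv
  have hv1 : ‖v‖ < 1 := by simpa using hv
  obtain ⟨ρ, h1, h2⟩ := exists_between hv1
  have h := Complex.differentiableOn_tsum_of_summable_norm (F := fun k v => γ k * v ^ k)
    (hγ ρ ((norm_nonneg v).trans_lt h1) h2) (fun k => by fun_prop)
    (Metric.isOpen_ball (x := (0 : ℂ)) (ε := ρ)) (fun k w hw => by
      have hw' : ‖w‖ < ρ := by simpa using hw
      rw [norm_mul, norm_pow]
      gcongr)
  exact (h.differentiableAt (Metric.isOpen_ball.mem_nhds (by simpa using h1))).differentiableWithinAt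

theorem norm_sq_add_sq_lt {r : ℝ} (hr : 0 < r) {w : ℂ} (h1 : w.re < r / 2) (h2 : -(r / 2) < w.re)
    (h3 : 9 / 10 * r < w.im) : ‖w ^ 2 + (r : ℂ) ^ 2‖ < ‖w ^ 2‖ := by
  have hx : w.re ^ 2 < r ^ 2 / 4 := by nlinarith
  have hy : 81 / 100 * r ^ 2 < w.im ^ 2 := by nlinarith
  refine lt_of_pow_lt_pow_left₀ 2 (norm_nonneg _) ?_
  rw [Complex.sq_norm, Complex.sq_norm, Complex.normSq_apply, Complex.normSq_apply]
  simp only [Complex.add_re, Complex.add_im, pow_two, Complex.mul_re, Complex.mul_im,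
    Complex.ofReal_re, Complex.ofReal_im]
  have : 0 < r ^ 2 * (w.im ^ 2 - w.re ^ 2 - r ^ 2 / 2) := by
    apply mul_pos (by positivity); nlinarith
  nlinarith

theorem exists_int_eq_of_summable {r R : ℝ} (hr : 0 < r) (hrR : r < R) {S C D : ℂ → ℂ} {μ : ℂ}
    (hC : Differentiable ℂ C) (hC0 : ∃ x, C x ≠ 0) (hD : Differentiable ℂ D)
    (hD0 : D (R * Complex.I) = 0) (hD' : deriv D (R * Complex.I) ≠ 0)
    (hS : AnalyticAt ℂ S (r * Complex.I)) (hS0 : S (r * Complex.I) ≠ 0)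
    (hSD : ∀ᶠ w in 𝓝 ((r : ℂ) * Complex.I), deriv S w * D w = -μ * S w * deriv D w)
    {γ : ℕ → ℂ} (hγ : ∀ ρ : ℝ, 0 < ρ → ρ < 1 → Summable fun k => ‖γ k‖ * ρ ^ k) (ε : ℕ)
    (hsum : ∀ᶠ w in 𝓝 ((r : ℂ) * Complex.I),
      HasSum (fun k => w ^ ε * (γ k * ((w ^ 2 + (r : ℂ) ^ 2) / w ^ 2) ^ k)) (S w * C w)) :
    ∃ m : ℤ, μ = m := by
  set T : Set ℂ := {w | w.re < r / 2} ∩ {w | -(r / 2) < w.re} ∩ {w | 9 / 10 * r < w.im} with hT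
  have hTo : IsOpen T := ((isOpen_lt Complex.continuous_re continuous_const).inter
    (isOpen_lt continuous_const Complex.continuous_re)).inter
    (isOpen_lt continuous_const Complex.continuous_im)
  have hTc : IsPreconnected T := (((convex_halfSpace_re_lt _).inter
    (convex_halfSpace_re_gt _)).inter (convex_halfSpace_im_gt _)).isPreconnected
  have hpT : (r : ℂ) * Complex.I ∈ T := by
    simp only [hT, Set.mem_inter_iff, Set.mem_ofPred_eq, Complex.re_ofReal_mul, Complex.im_ofReal_mul,
      Complex.I_re, Complex.I_im]
    refine ⟨⟨?_, ?_⟩, ?_⟩ <;> linarith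
  have hqT : (R : ℂ) * Complex.I ∈ T := by
    simp only [hT, Set.mem_inter_iff, Set.mem_ofPred_eq, Complex.re_ofReal_mul, Complex.im_ofReal_mul,
      Complex.I_re, Complex.I_im]
    refine ⟨⟨?_, ?_⟩, ?_⟩ <;> linarith
  set A : ℂ → ℂ := fun v => ∑' k, γ k * v ^ k with hA
  set U : ℂ → ℂ := fun w => w ^ ε * A ((w ^ 2 + (r : ℂ) ^ 2) / w ^ 2) with hU
  have hT0 : ∀ w ∈ T, w ^ 2 ≠ 0 := by
    rintro w ⟨⟨h1, h2⟩, h3⟩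
    exact norm_pos_iff.1 ((norm_nonneg _).trans_lt (norm_sq_add_sq_lt hr h1 h2 h3))
  have hUd : DifferentiableOn ℂ U T := by
    refine DifferentiableOn.mul (by fun_prop) ?_
    refine (differentiableOn_tsum_mul_pow hγ).fun_comp
      (DifferentiableOn.div (by fun_prop) (by fun_prop) hT0) ?_
    rintro w hw
    rw [mem_ball_zero_iff, norm_div, div_lt_one (norm_pos_iff.2 (hT0 w hw))]
    exact norm_sq_add_sq_lt hr hw.1.1 hw.1.2 hw.2
  have hUa : AnalyticOnNhd ℂ U T := hUd.analyticOnNhd hTo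
  have hCa : AnalyticOnNhd ℂ C Set.univ := hC.differentiableOn.analyticOnNhd isOpen_univ
  have hDa : AnalyticOnNhd ℂ D Set.univ := hD.differentiableOn.analyticOnNhd isOpen_univ
  have hUS : U =ᶠ[𝓝 ((r : ℂ) * Complex.I)] fun w => S w * C w := by
    filter_upwards [hsum] with w hw
    rw [← hw.tsum_eq, tsum_mul_left]
  have hCz : ∀ a : ℂ, ¬ ∀ᶠ w in 𝓝 a, C w = 0 := by
    intro a h
    obtain ⟨x, hx⟩ := hC0
    exact hx (hCa.eqOn_zero_of_preconnected_of_eventuallyEq_zero isPreconnected_univ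
      (Set.mem_univ a) h (Set.mem_univ x))
  have hUz : ¬ ∀ᶠ w in 𝓝 ((R : ℂ) * Complex.I), U w = 0 := by
    intro h
    have h1 := hUa.eqOn_zero_of_preconnected_of_eventuallyEq_zero hTc hqT h
    refine hCz (r * Complex.I) ?_
    filter_upwards [hUS, hTo.mem_nhds hpT, hS.continuousAt.eventually_ne hS0] with w e1 e2 e3
    rw [h1 e2] at e1
    exact (mul_eq_zero.1 e1.symm).resolve_left e3
  have hode : Set.EqOn (fun w => deriv U w * D w * C w)
      (fun w => U w * (-μ * deriv D w * C w + D w * deriv C w)) T := by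
    have hC1 := hCa.mono (Set.subset_univ T)
    have hD1 := hDa.mono (Set.subset_univ T)
    refine AnalyticOnNhd.eqOn_of_preconnected_of_eventuallyEq
      ((hUa.deriv.mul hD1).mul hC1) (hUa.mul (((analyticOnNhd_const.mul hD1.deriv).mul hC1).add
      (hD1.mul hC1.deriv))) hTc hpT ?_
    have hdU : deriv U =ᶠ[𝓝 ((r : ℂ) * Complex.I)] deriv fun w => S w * C w := hUS.deriv
    filter_upwards [hUS, hdU, hSD, hS.eventually_analyticAt] with w e1 e2 e3 e4
    have e5 : deriv (fun w => S w * C w) w = deriv S w * C w + S w * deriv C w :=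
      (e4.differentiableAt.hasDerivAt.mul (hC w).hasDerivAt).deriv
    rw [e1, e2, e5]
    linear_combination C w ^ 2 * e3
  refine exists_int_eq_of_ode (hUa _ hqT) (hCa _ (Set.mem_univ _)) (hDa _ (Set.mem_univ _)) hUz
    (hCz _) hD0 hD' ?_
  filter_upwards [hTo.mem_nhds hqT] with w hw using hode hw

theorem expansionTerm_ne_zero {μ : ℂ} (hμ : ∀ m : ℤ, μ ≠ m) {r : ℝ} (hr : r ≠ 0) (k n : ℕ) :
    expansionTerm r μ k n ≠ 0 := by
  have h1 : ∀ m : ℕ, μ - k ≠ -m := fun m h => hμ (k - m) (by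
    push_cast; linear_combination h)
  have h2 : ((n + k)! : ℂ) ≠ 0 := by exact_mod_cast (n + k).factorial_ne_zero
  have h3 : (r : ℂ) ≠ 0 := by exact_mod_cast hr
  have h4 := ascPochhammer_eval_ne_zero h1 (n + k)
  have h5 : ((-1 : ℂ)) ^ (n + k) ≠ 0 := pow_ne_zero _ (by norm_num)
  unfold expansionTerm
  positivity

theorem expansionTerm_succ (r : ℝ) (μ : ℂ) (k n : ℕ) :
    expansionTerm r μ (k + 1) n * (n + 1 + k) = expansionTerm r μ k n * ((1 - μ) + k) := by
  have h1 : (ascPochhammer ℂ (n + (k + 1))).eval (μ - (k + 1 : ℕ)) =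
      (ascPochhammer ℂ (n + k)).eval (μ - k) * (μ - (k + 1)) := by
    rw [ascPochhammer_eval_eq_prod, ascPochhammer_eval_eq_prod, ← add_assoc,
      Finset.prod_range_succ']
    congr 1
    · refine Finset.prod_congr rfl fun j _ => ?_
      push_cast; ring
    · push_cast; ring
  have h2 : ((n + k)! : ℂ) ≠ 0 := by exact_mod_cast (n + k).factorial_ne_zero
  have h3 : ((n : ℂ) + k + 1) ≠ 0 := by exact_mod_cast (n + k).succ_ne_zero
  have h4 : ((n + (k + 1))! : ℂ) = ((n : ℂ) + k + 1) * ((n + k)! : ℂ) := by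
    rw [← add_assoc, Nat.factorial_succ]; push_cast; ring
  rw [expansionTerm, expansionTerm, h1, h4, ← add_assoc, pow_succ (-1 : ℂ)]
  by_cases hr : (r : ℂ) ^ (2 * n) = 0
  · simp [hr]
  · field_simp
    ring

theorem summable_norm_mul_pow {μ : ℂ} (hμ : ∀ m : ℤ, μ ≠ m) {r : ℝ} (hr : r ≠ 0) {n : ℕ}
    {γ : ℕ → ℂ} {B : ℝ} (hB : ∀ k, ‖γ k * expansionTerm r μ k n‖ ≤ B) {ρ : ℝ} (hρ : 0 < ρ)
    (hρ1 : ρ < 1) : Summable fun k => ‖γ k‖ * ρ ^ k := by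
  have hE := fun k => expansionTerm_ne_zero hμ hr k n
  have h1 : Summable fun k : ℕ => (ρ : ℂ) ^ k / expansionTerm r μ k n := by
    refine summable_of_ratio_test_tendsto_lt_one hρ1
      (Eventually.of_forall fun k => div_ne_zero (pow_ne_zero _ (by exact_mod_cast hρ.ne')) (hE k)) ?_
    have t1 := (((tendsto_natCast_div_add (1 - μ)).div (tendsto_natCast_div_add (n + 1))
      one_ne_zero).norm).const_mul ρ
    rw [div_one, norm_one, mul_one] at t1
    refine t1.congr' ?_
    filter_upwards [eventually_ge_atTop 1] with k hk
    have hk' : (k : ℂ) ≠ 0 := by exact_mod_cast (by omega : k ≠ 0)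
    have hn' : ((n : ℂ) + 1 + k) ≠ 0 := by exact_mod_cast (by omega : n + 1 + k ≠ 0)
    have hm' : (1 - μ + k) ≠ 0 := fun h => hμ (1 + k) (by push_cast; linear_combination -h)
    have hs := expansionTerm_succ r μ k n
    have hρ' : (ρ : ℂ) ≠ 0 := by exact_mod_cast hρ.ne'
    rw [← norm_div]
    conv_lhs => rw [← Real.norm_of_nonneg hρ.le, ← Complex.norm_real, ← norm_mul]
    congr 1
    have h1 := hE k
    have h2 := hE (k + 1)
    rw [Pi.div_apply, pow_succ]
    field_simp
    linear_combination hs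
  have h2 := (h1.norm).mul_left B
  refine Summable.of_nonneg_of_le (fun k => by positivity) (fun k => ?_) h2
  have h3 := hB k
  rw [norm_mul] at h3
  rw [norm_div, norm_pow, Complex.norm_real, Real.norm_of_nonneg hρ.le, ← mul_div_assoc,
    le_div_iff₀ (norm_pos_iff.2 (hE k))]
  nlinarith [pow_pos hρ k]

theorem exists_bound_of_not_seriesDiverges {t : ℕ → ℂ} (h : ¬ SeriesDiverges t) :
    ∃ B, ∀ k, ‖t k‖ ≤ B := by
  simp only [SeriesDiverges, not_not] at h
  obtain ⟨l, hl⟩ := h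
  have h1 : Tendsto t atTop (𝓝 0) := by
    have := (hl.comp (tendsto_add_atTop_nat 1)).sub hl
    simpa [Function.comp_def, Finset.sum_range_succ] using this
  obtain ⟨B, hB⟩ := h1.norm.bddAbove_range
  exact ⟨B, fun k => hB (Set.mem_range_self k)⟩

section

variable {r R : ℝ} (hr : 0 < r) (hrR : r < R) {F S D : ℂ → ℂ} {μ c : ℂ}
  (hμ : ∀ m : ℤ, μ ≠ m)
  (hF : DifferentiableOn ℂ F (Metric.ball 0 R)) (hD : Differentiable ℂ D)
  (hD0 : D (R * Complex.I) = 0) (hD' : deriv D (R * Complex.I) ≠ 0)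
  (hS : DifferentiableOn ℂ S (Metric.ball 0 R))
  (hS0 : ∀ w ∈ Metric.ball (0 : ℂ) R, S w ≠ 0)
  (hSe : ∀ w ∈ Metric.ball (0 : ℂ) R, S (-w) = S w)
  (hSD : ∀ w ∈ Metric.ball (0 : ℂ) R, deriv S w * D w = -μ * S w * deriv D w)
  (hFS : ∀ w ∈ Metric.ball (0 : ℂ) R, F w = S w * Complex.exp (c * w))

include hr hrR hF hSe hFS

theorem eventually_hasSum_parts : ∀ᶠ w in 𝓝 ((r : ℂ) * Complex.I),
    HasSum (fun k => w ^ 0 * (twoPointA (r * Complex.I) F k *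
      ((w ^ 2 + (r : ℂ) ^ 2) / w ^ 2) ^ k)) (S w * Complex.cosh (c * w)) ∧
    HasSum (fun k => w ^ 1 * (twoPointB (r * Complex.I) F k *
      ((w ^ 2 + (r : ℂ) ^ 2) / w ^ 2) ^ k)) (S w * Complex.sinh (c * w)) := by
  have hr' : (r : ℂ) ≠ 0 := by exact_mod_cast hr.ne'
  have hpR : ‖(r : ℂ) * Complex.I‖ < R := by simpa [abs_of_pos hr] using hrR
  have h := eventually_hasSum_twoPoint (mul_ne_zero hr' Complex.I_ne_zero) hpR hF
  obtain ⟨h1, h2⟩ := eventually_sup.1 h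
  have h3 : Metric.ball (0 : ℂ) R ∈ 𝓝 ((r : ℂ) * Complex.I) :=
    Metric.isOpen_ball.mem_nhds (by simpa using hpR)
  have hp2 : ∀ w : ℂ, w ^ 2 - ((r : ℂ) * Complex.I) ^ 2 = w ^ 2 + (r : ℂ) ^ 2 := fun w => by
    rw [mul_pow, Complex.I_sq]; ring
  filter_upwards [h1, tendsto_id.neg.eventually h2, h3] with w e1 e2 e3
  have e3' : -w ∈ Metric.ball (0 : ℂ) R := by simpa using e3
  simp only [id] at e2
  rw [hFS w e3] at e1
  rw [hFS _ e3', hSe w e3] at e2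
  simp only [neg_sq, hp2] at e1 e2
  constructor
  · have := (e1.add e2).div_const 2
    rw [← mul_add, mul_neg, mul_div_assoc] at this
    exact this.congr_fun fun k => by ring
  · have := (e1.sub e2).div_const 2
    rw [← mul_sub, mul_neg, mul_div_assoc] at this
    exact this.congr_fun fun k => by ring

include hμ hD hD0 hD' hS hS0 hSD

theorem seriesDiverges_twoPointA (n : ℕ) {t : ℕ → ℂ} {b : ℂ} (hb : b ≠ 0)
    (ht : ∀ k, t k = b * expansionTerm r μ k n) :
    SeriesDiverges fun k => twoPointA (r * Complex.I) F k * t k := by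
  by_contra hcon
  obtain ⟨B, hB⟩ := exists_bound_of_not_seriesDiverges hcon
  have hpR : (r : ℂ) * Complex.I ∈ Metric.ball (0 : ℂ) R := by simpa [abs_of_pos hr] using hrR
  have hnh := Metric.isOpen_ball.mem_nhds hpR
  have hB' : ∀ k, ‖twoPointA (r * Complex.I) F k * expansionTerm r μ k n‖ ≤ B / ‖b‖ := fun k => by
    rw [le_div_iff₀ (norm_pos_iff.2 hb), ← norm_mul]
    refine le_trans (le_of_eq ?_) (hB k)
    rw [ht]; ring_nf
  obtain ⟨m, hm⟩ := exists_int_eq_of_summable hr hrR (C := fun w => Complex.cosh (c * w)) (μ := μ)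
    (by fun_prop) ⟨0, by simp⟩ hD hD0 hD' (hS.analyticAt hnh) (hS0 _ hpR)
    (by filter_upwards [hnh] with w hw using hSD w hw)
    (fun ρ h1 h2 => summable_norm_mul_pow hμ hr.ne' hB' h1 h2) 0
    ((eventually_hasSum_parts hr hrR hF hSe hFS).mono fun w hw => hw.1)
  exact hμ m hm

theorem seriesDiverges_twoPointB (hc : c ≠ 0) (n : ℕ) {t : ℕ → ℂ} {b : ℂ} (hb : b ≠ 0)
    (ht : ∀ k, t k = b * expansionTerm r μ k n) :
    SeriesDiverges fun k => twoPointB (r * Complex.I) F k * t k := by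
  by_contra hcon
  obtain ⟨B, hB⟩ := exists_bound_of_not_seriesDiverges hcon
  have hpR : (r : ℂ) * Complex.I ∈ Metric.ball (0 : ℂ) R := by simpa [abs_of_pos hr] using hrR
  have hnh := Metric.isOpen_ball.mem_nhds hpR
  have hB' : ∀ k, ‖twoPointB (r * Complex.I) F k * expansionTerm r μ k n‖ ≤ B / ‖b‖ := fun k => by
    rw [le_div_iff₀ (norm_pos_iff.2 hb), ← norm_mul]
    refine le_trans (le_of_eq ?_) (hB k)
    rw [ht]; ring_nf
  obtain ⟨m, hm⟩ := exists_int_eq_of_summable hr hrR (C := fun w => Complex.sinh (c * w)) (μ := μ)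
    (by fun_prop) ⟨Complex.I / c, by
      rw [mul_div_cancel₀ _ hc, ← one_mul Complex.I, Complex.sinh_mul_I]
      exact mul_ne_zero (by
        rw [← Complex.ofReal_one, ← Complex.ofReal_sin]
        exact_mod_cast (Real.sin_pos_of_pos_of_lt_pi one_pos (by linarith [Real.pi_gt_three])).ne')
        Complex.I_ne_zero⟩
    hD hD0 hD' (hS.analyticAt hnh) (hS0 _ hpR)
    (by filter_upwards [hnh] with w hw using hSD w hw)
    (fun ρ h1 h2 => summable_norm_mul_pow hμ hr.ne' hB' h1 h2) 1
    ((eventually_hasSum_parts hr hrR hF hSe hFS).mono fun w hw => hw.2)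
  exact hμ m hm

end

theorem eventuallyEq_of_exp_eq {X Y : ℂ → ℂ} {a : ℂ} (hX : ContinuousAt X a)
    (hY : ContinuousAt Y a) (ha : X a = Y a)
    (h : ∀ᶠ w in 𝓝 a, Complex.exp (X w) = Complex.exp (Y w)) : X =ᶠ[𝓝 a] Y := by
  have h1 : Tendsto (fun w => (X w - Y w).im) (𝓝 a) (𝓝 0) := by
    have : ContinuousAt (fun w => (X w - Y w).im) a :=
      Complex.continuous_im.continuousAt.comp (hX.sub hY)
    simpa [ContinuousAt, ha] using this
  filter_upwards [h, h1.eventually (Ioo_mem_nhds (neg_lt_zero.2 Real.pi_pos) Real.pi_pos)]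
    with w hw him
  have h2 : Complex.exp (X w - Y w) = 1 := by
    rw [Complex.exp_sub, hw, div_self (Complex.exp_ne_zero _)]
  have h3 := Complex.log_exp him.1 him.2.le
  rw [h2, Complex.log_one] at h3
  exact sub_eq_zero.1 h3.symm

theorem eqOn_ball_of_deriv_eq_zero {R : ℝ} {G : ℂ → ℂ}
    (hG : ∀ w ∈ Metric.ball (0 : ℂ) R, HasDerivAt G 0 w) {w : ℂ} (hw : w ∈ Metric.ball (0 : ℂ) R) :
    G w = G 0 := by
  have h0 : (0 : ℂ) ∈ Metric.ball (0 : ℂ) R := by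
    rw [mem_ball_zero_iff] at hw ⊢
    simpa using (norm_nonneg w).trans_lt hw
  refine (convex_ball (0 : ℂ) R).is_const_of_fderivWithin_eq_zero (𝕜 := ℂ)
    (fun x hx => (hG x hx).differentiableAt.differentiableWithinAt) (fun x hx => ?_) hw h0
  rw [fderivWithin_of_isOpen Metric.isOpen_ball hx]
  ext
  simpa using (hG x hx).deriv

theorem exists_even_log {R : ℝ} {D : ℂ → ℂ} (hD : Differentiable ℂ D) (he : ∀ w, D (-w) = D w)
    (h0 : ∀ w ∈ Metric.ball (0 : ℂ) R, D w ≠ 0) :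
    ∃ ℓ : ℂ → ℂ, ℓ 0 = 0 ∧ ∀ w ∈ Metric.ball (0 : ℂ) R,
      HasDerivAt ℓ (deriv D w / D w) w ∧ Complex.exp (ℓ w) = D w / D 0 ∧ ℓ (-w) = ℓ w := by
  have hDD : Differentiable ℂ (deriv D) := (hD.contDiff (n := 2)).differentiable_deriv_two
  have hd : DifferentiableOn ℂ (fun w => deriv D w / D w) (Metric.ball 0 R) :=
    hDD.differentiableOn.div hD.differentiableOn h0
  obtain ⟨ℓ, hℓ0, hℓ⟩ := hd.isExactOn_ball.with_val_at 0 0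
  refine ⟨ℓ, hℓ0, fun w hw => ⟨hℓ w hw, ?_, ?_⟩⟩
  · have h1 := eqOn_ball_of_deriv_eq_zero (G := fun w => D w * Complex.exp (-ℓ w)) (fun x hx => by
      have := (hD x).hasDerivAt.mul ((hℓ x hx).neg.cexp)
      refine this.congr_deriv ?_
      have := h0 x hx
      field_simp
      simp) hw
    simp only [hℓ0, neg_zero, Complex.exp_zero, mul_one] at h1
    have h2 : D w ≠ 0 := h0 w hw
    rw [← h1, Complex.exp_neg]
    have := Complex.exp_ne_zero (ℓ w)
    field_simp
  · have hdo : ∀ x, deriv D (-x) = -deriv D x := fun x => by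
      have h1 : HasDerivAt (fun x => D (-x)) (deriv D (-x) * -1) x :=
        (hD (-x)).hasDerivAt.comp x (hasDerivAt_neg x)
      have h2 : (fun x => D (-x)) = D := funext he
      rw [h2] at h1
      rw [h1.deriv]; ring
    have h1 := eqOn_ball_of_deriv_eq_zero (G := fun w => ℓ (-w) - ℓ w) (fun x hx => by
      have hx' : -x ∈ Metric.ball (0 : ℂ) R := by simpa using hx
      have := ((hℓ (-x) hx').comp x (hasDerivAt_neg x)).sub (hℓ x hx)
      refine this.congr_deriv ?_
      rw [hdo, he]
      ring) hw
    simpa [sub_eq_zero] using h1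

theorem taylorContinuation_eqOn {Γ F : ℂ → ℂ} {R : ℝ} (h : Γ =ᶠ[𝓝 0] F)
    (hF : DifferentiableOn ℂ F (Metric.ball 0 R)) :
    Set.EqOn (taylorContinuation Γ) F (Metric.ball 0 R) := by
  intro w hw
  have h1 := hasSum_taylorCoeff_ball hF hw
  rw [← h1.tsum_eq, taylorContinuation]
  exact tsum_congr fun n => by rw [← taylorCoeff_congr h]; rfl

theorem exists_even_dvd {h : ℂ → ℂ} {p : ℂ} (hp : p ≠ 0) (hh : Differentiable ℂ h)
    (he : ∀ w, h (-w) = h w) (h0 : h p = 0) :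
    ∃ D : ℂ → ℂ, Differentiable ℂ D ∧ (∀ w, D (-w) = D w) ∧ ∀ w, h w = (w ^ 2 - p ^ 2) * D w := by
  have h1 : ∀ v, (v - p) * dslope h p v = h v := fun v => by simpa [h0] using sub_smul_dslope h p v
  have h2 : dslope h p (-p) = 0 := by
    have := h1 (-p)
    rw [he, h0, mul_eq_zero] at this
    refine this.resolve_left fun h0 => hp ?_
    linear_combination (-1 / 2 : ℂ) * h0
  have h3 : ∀ w, (w ^ 2 - p ^ 2) * dslope (dslope h p) (-p) w = h w := fun w => by
    have : (w + p) * dslope (dslope h p) (-p) w = dslope h p w := by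
      simpa [h2] using sub_smul_dslope (dslope h p) (-p) w
    rw [← h1 w, ← this]
    ring
  have hE : Differentiable ℂ (dslope (dslope h p) (-p)) := by
    rw [← differentiableOn_univ, Complex.differentiableOn_dslope univ_mem,
      Complex.differentiableOn_dslope univ_mem, differentiableOn_univ]
    exact hh
  set E := dslope (dslope h p) (-p)
  refine ⟨fun w => (E w + E (-w)) / 2, ?_, fun w => by simp only [neg_neg]; rw [add_comm], fun w => ?_⟩
  · exact (hE.add (hE.comp differentiable_neg)).div_const 2
  · have h4 := h3 w
    have h5 := h3 (-w)
    rw [he, neg_sq] at h5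
    linear_combination (-1 / 2 : ℂ) * h4 + (-1 / 2 : ℂ) * h5

section

variable {h q D : ℂ → ℂ} (hq : Differentiable ℂ q) (hD : Differentiable ℂ D)
  (hqD : ∀ w, h w = q w * D w)

include hq hD hqD

theorem deriv_eq_of_eq_mul (w : ℂ) : deriv h w = deriv q w * D w + q w * deriv D w := by
  rw [funext hqD]
  exact ((hq w).hasDerivAt.mul (hD w).hasDerivAt).deriv

theorem factor_ne_zero {w : ℂ} (h1 : h w = 0 → deriv h w ≠ 0) (h2 : h w = 0 → q w = 0) :
    D w ≠ 0 := by
  intro hw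
  have h0 : h w = 0 := by rw [hqD, hw, mul_zero]
  apply h1 h0
  rw [deriv_eq_of_eq_mul hq hD hqD, hw, h2 h0]
  ring

theorem factor_simple_zero {w : ℂ} (h0 : h w = 0) (h1 : deriv h w ≠ 0) (h2 : q w ≠ 0) :
    D w = 0 ∧ deriv D w ≠ 0 := by
  have h3 : D w = 0 := by
    have := hqD w
    rw [h0] at this
    exact (mul_eq_zero.1 this.symm).resolve_left h2
  refine ⟨h3, fun h4 => h1 ?_⟩
  rw [deriv_eq_of_eq_mul hq hD hqD, h3, h4]
  ring

end

theorem exists_int_of_norm_lt {w : ℂ} {m : ℤ} {r : ℝ} {N : ℕ} (hr : 0 < r)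
    (hw : w = m * (r * Complex.I)) (h : ‖w‖ < N * r) : |m| < N := by
  rw [hw, norm_mul, norm_mul, Complex.norm_I, mul_one, Complex.norm_real, Real.norm_of_nonneg hr.le,
    Complex.norm_intCast] at h
  have := lt_of_mul_lt_mul_right h hr.le
  exact_mod_cast this

theorem exists_bernoulliFactor : ∃ D : ℂ → ℂ, Differentiable ℂ D ∧ (∀ w, D (-w) = D w) ∧
    (∀ w, Complex.exp w - 1 =
      Complex.exp (w / 2) * (w * (w ^ 2 + 4 * (Real.pi : ℂ) ^ 2) * D w)) ∧
    (∀ w ∈ Metric.ball (0 : ℂ) (4 * Real.pi), D w ≠ 0) ∧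
    D ((4 * Real.pi : ℝ) * Complex.I) = 0 ∧ deriv D ((4 * Real.pi : ℝ) * Complex.I) ≠ 0 ∧
    D 0 * (4 * (Real.pi : ℂ) ^ 2) = 1 ∧ D pB * (8 * (Real.pi : ℂ) ^ 2) = 1 := by
  have hπ : (Real.pi : ℂ) ≠ 0 := by exact_mod_cast Real.pi_ne_zero
  set h : ℂ → ℂ := fun w => Complex.exp (w / 2) - Complex.exp (-w / 2) with hh
  have hd : ∀ w, HasDerivAt h ((Complex.exp (w / 2) + Complex.exp (-w / 2)) / 2) w := fun w => by
    have h1 := ((hasDerivAt_id w).div_const 2).cexp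
    have h2 := ((hasDerivAt_id w).neg.div_const 2).cexp
    exact (h1.sub h2).congr_deriv (by simp; ring)
  have hdiff : Differentiable ℂ h := fun w => (hd w).differentiableAt
  have hexp : ∀ w, Complex.exp w - 1 = Complex.exp (w / 2) * h w := fun w => by
    simp only [hh, mul_sub, ← Complex.exp_add]
    ring_nf
    simp only [Complex.exp_zero]
    ring
  have hz : ∀ w, h w = 0 ↔ ∃ m : ℤ, w = m * ((2 * Real.pi : ℝ) * Complex.I) := fun w => by
    have := hexp w
    rw [← Complex.ofReal_ofNat] at *
    constructor
    · intro h0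
      rw [h0, mul_zero, sub_eq_zero, Complex.exp_eq_one_iff] at this
      simpa using this
    · intro h1
      have h2 : Complex.exp w = 1 := Complex.exp_eq_one_iff.2 (by simpa using h1)
      rw [h2, sub_self] at this
      exact (mul_eq_zero.1 this.symm).resolve_left (Complex.exp_ne_zero _)
  have hz' : ∀ w, h w = 0 → deriv h w ≠ 0 := fun w h0 h1 => by
    rw [(hd w).deriv] at h1
    have : Complex.exp (w / 2) = 0 := by
      simp only [hh] at h0
      linear_combination h1 + h0 / 2
    exact Complex.exp_ne_zero _ this
  have hh0 : h 0 = 0 := by simp [hh]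
  have h1 : ∀ v, v * dslope h 0 v = h v := fun v => by simpa [hh0] using sub_smul_dslope h 0 v
  have hk : Differentiable ℂ (dslope h 0) := by
    rw [← differentiableOn_univ, Complex.differentiableOn_dslope univ_mem, differentiableOn_univ]
    exact hdiff
  have hpB : pB ≠ 0 := by simp [pB, hπ]
  have hk0 : dslope h 0 pB = 0 := by
    have h2 : h pB = 0 := (hz _).2 ⟨1, by simp [pB]⟩
    have := h1 pB
    rw [h2] at this
    exact (mul_eq_zero.1 this).resolve_left hpB
  have hke : ∀ w, dslope h 0 (-w) = dslope h 0 w := fun w => by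
    rcases eq_or_ne w 0 with rfl | hw
    · rw [neg_zero]
    · have e1 := h1 w
      have e2 := h1 (-w)
      have e3 : h (-w) = -h w := by simp [hh]
      refine mul_left_cancel₀ hw ?_
      linear_combination -e1 - e2 - e3
  obtain ⟨D, hD, hDe, hDk⟩ := exists_even_dvd hpB hk hke hk0
  have hp2 : pB ^ 2 = -(4 * (Real.pi : ℂ) ^ 2) := by
    rw [pB, mul_pow, Complex.I_sq]; ring
  have hqD : ∀ w, h w = w * (w ^ 2 + 4 * (Real.pi : ℂ) ^ 2) * D w := fun w => by
    rw [← h1, hDk, hp2]; ring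
  have hqd : ∀ w : ℂ, HasDerivAt (fun w : ℂ => w * (w ^ 2 + 4 * (Real.pi : ℂ) ^ 2))
      (3 * w ^ 2 + 4 * (Real.pi : ℂ) ^ 2) w := fun w => by
    have := (hasDerivAt_id w).mul (((hasDerivAt_id w).pow 2).add_const (4 * (Real.pi : ℂ) ^ 2))
    exact this.congr_deriv (by simp; ring)
  have hq : Differentiable ℂ fun w : ℂ => w * (w ^ 2 + 4 * (Real.pi : ℂ) ^ 2) := by fun_prop
  have hder := deriv_eq_of_eq_mul hq hD hqD
  have h4 : h ((4 * Real.pi : ℝ) * Complex.I) = 0 := (hz _).2 ⟨2, by push_cast; ring⟩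
  have hs := factor_simple_zero hq hD hqD h4 (hz' _ h4) (by
    have : ((4 * Real.pi : ℝ) : ℂ) * Complex.I *
        ((((4 * Real.pi : ℝ) : ℂ) * Complex.I) ^ 2 + 4 * (Real.pi : ℂ) ^ 2) =
        -48 * (Real.pi : ℂ) ^ 3 * Complex.I := by
      rw [mul_pow, Complex.I_sq]; push_cast; ring
    rw [this]
    simp [hπ])
  refine ⟨D, hD, hDe, fun w => by rw [hexp, hqD], fun w hw => ?_, hs.1, hs.2, ?_, ?_⟩
  · refine factor_ne_zero hq hD hqD (hz' w) fun h0 => ?_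
    obtain ⟨m, hm⟩ := (hz w).1 h0
    have h5 := exists_int_of_norm_lt (N := 2) (by positivity) hm (by
      rw [mem_ball_zero_iff] at hw
      refine hw.trans_le (le_of_eq ?_)
      push_cast; ring)
    have h6 : m = 0 ∨ m = 1 ∨ m = -1 := by
      rw [abs_lt] at h5
      push_cast at h5
      omega
    have hI := Complex.I_sq
    rcases h6 with rfl | rfl | rfl
    · simp [hm]
    · rw [hm]; push_cast
      linear_combination (2 * Real.pi * Complex.I * (4 * Real.pi ^ 2) : ℂ) * hI
    · rw [hm]; push_cast
      linear_combination (-2 * Real.pi * Complex.I * (4 * Real.pi ^ 2) : ℂ) * hI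
  · have := hder 0
    rw [(hd 0).deriv, (hqd 0).deriv] at this
    norm_num at this
    rw [mul_comm]; exact this.symm
  · have := hder pB
    rw [(hd pB).deriv, (hqd pB).deriv, hp2] at this
    have e1 : Complex.exp (pB / 2) = -1 := by
      rw [pB, show 2 * (Real.pi : ℂ) * Complex.I / 2 = Real.pi * Complex.I by ring,
        Complex.exp_pi_mul_I]
    have e2 : Complex.exp (-pB / 2) = -1 := by
      rw [neg_div, Complex.exp_neg, e1]; norm_num
    rw [e1, e2] at this
    linear_combination this

theorem exists_eulerFactor : ∃ D : ℂ → ℂ, Differentiable ℂ D ∧ (∀ w, D (-w) = D w) ∧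
    (∀ w, Complex.exp w + 1 = Complex.exp (w / 2) * ((w ^ 2 + (Real.pi : ℂ) ^ 2) * D w)) ∧
    (∀ w ∈ Metric.ball (0 : ℂ) (3 * Real.pi), D w ≠ 0) ∧
    D ((3 * Real.pi : ℝ) * Complex.I) = 0 ∧ deriv D ((3 * Real.pi : ℝ) * Complex.I) ≠ 0 ∧
    D 0 * (Real.pi : ℂ) ^ 2 = 2 ∧ D pE * (2 * (Real.pi : ℂ)) = 1 := by
  have hπ : (Real.pi : ℂ) ≠ 0 := by exact_mod_cast Real.pi_ne_zero
  set h : ℂ → ℂ := fun w => Complex.exp (w / 2) + Complex.exp (-w / 2) with hh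
  have hd : ∀ w, HasDerivAt h ((Complex.exp (w / 2) - Complex.exp (-w / 2)) / 2) w := fun w => by
    have h1 := ((hasDerivAt_id w).div_const 2).cexp
    have h2 := ((hasDerivAt_id w).neg.div_const 2).cexp
    exact (h1.add h2).congr_deriv (by simp; ring)
  have hdiff : Differentiable ℂ h := fun w => (hd w).differentiableAt
  have hexp : ∀ w, Complex.exp w + 1 = Complex.exp (w / 2) * h w := fun w => by
    simp only [hh, mul_add, ← Complex.exp_add]
    ring_nf
    simp only [Complex.exp_zero]
    ring
  have hz : ∀ w, h w = 0 ↔ ∃ m : ℤ, w = (2 * m + 1 : ℤ) * (Real.pi * Complex.I) := fun w => by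
    have e1 := hexp w
    have e2 : Complex.exp (w - Real.pi * Complex.I) = -Complex.exp w := by
      rw [Complex.exp_sub, Complex.exp_pi_mul_I]; ring
    constructor
    · intro h0
      rw [h0, mul_zero] at e1
      have e3 : Complex.exp (w - Real.pi * Complex.I) = 1 := by rw [e2]; linear_combination -e1
      obtain ⟨m, hm⟩ := Complex.exp_eq_one_iff.1 e3
      exact ⟨m, by push_cast; linear_combination hm⟩
    · rintro ⟨m, hm⟩
      have e3 : Complex.exp (w - Real.pi * Complex.I) = 1 :=
        Complex.exp_eq_one_iff.2 ⟨m, by rw [hm]; push_cast; ring⟩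
      have e4 : Complex.exp (w / 2) * h w = 0 := by rw [← e1]; linear_combination e2 - e3
      exact (mul_eq_zero.1 e4).resolve_left (Complex.exp_ne_zero _)
  have hz' : ∀ w, h w = 0 → deriv h w ≠ 0 := fun w h0 h1 => by
    rw [(hd w).deriv] at h1
    have : Complex.exp (w / 2) = 0 := by
      simp only [hh] at h0
      linear_combination h1 + h0 / 2
    exact Complex.exp_ne_zero _ this
  have hpE : pE ≠ 0 := by simp [pE, hπ]
  have hk0 : h pE = 0 := (hz _).2 ⟨0, by simp [pE]⟩
  have hke : ∀ w, h (-w) = h w := fun w => by simp [hh, add_comm]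
  obtain ⟨D, hD, hDe, hDk⟩ := exists_even_dvd hpE hdiff hke hk0
  have hp2 : pE ^ 2 = -(Real.pi : ℂ) ^ 2 := by
    rw [pE, mul_pow, Complex.I_sq]; ring
  have hqD : ∀ w, h w = (w ^ 2 + (Real.pi : ℂ) ^ 2) * D w := fun w => by
    rw [hDk, hp2]; ring
  have hqd : ∀ w : ℂ, HasDerivAt (fun w : ℂ => w ^ 2 + (Real.pi : ℂ) ^ 2) (2 * w) w := fun w => by
    have := ((hasDerivAt_id w).pow 2).add_const ((Real.pi : ℂ) ^ 2)
    exact this.congr_deriv (by simp)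
  have hq : Differentiable ℂ fun w : ℂ => w ^ 2 + (Real.pi : ℂ) ^ 2 := by fun_prop
  have hder := deriv_eq_of_eq_mul hq hD hqD
  have h4 : h ((3 * Real.pi : ℝ) * Complex.I) = 0 := (hz _).2 ⟨1, by push_cast; ring⟩
  have hs := factor_simple_zero hq hD hqD h4 (hz' _ h4) (by
    have : (((3 * Real.pi : ℝ) : ℂ) * Complex.I) ^ 2 + (Real.pi : ℂ) ^ 2 =
        -8 * (Real.pi : ℂ) ^ 2 := by
      rw [mul_pow, Complex.I_sq]; push_cast; ring
    rw [this]
    simp [hπ])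
  refine ⟨D, hD, hDe, fun w => by rw [hexp, hqD], fun w hw => ?_, hs.1, hs.2, ?_, ?_⟩
  · refine factor_ne_zero hq hD hqD (hz' w) fun h0 => ?_
    obtain ⟨m, hm⟩ := (hz w).1 h0
    have h5 := exists_int_of_norm_lt (N := 3) Real.pi_pos hm (by simpa using hw)
    have h6 : m = 0 ∨ m = -1 := by
      rw [abs_lt] at h5
      push_cast at h5
      omega
    have hI := Complex.I_sq
    rcases h6 with rfl | rfl
    · rw [hm]; push_cast
      linear_combination (Real.pi ^ 2 : ℂ) * hI
    · rw [hm]; push_cast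
      linear_combination (Real.pi ^ 2 : ℂ) * hI
  · have := hqD 0
    simp only [hh] at this
    norm_num at this
    rw [mul_comm]; exact this.symm
  · have := hder pE
    rw [(hd pE).deriv, (hqd pE).deriv, hp2] at this
    have e1 : Complex.exp (pE / 2) = Complex.I := by
      rw [pE, show (Real.pi : ℂ) * Complex.I / 2 = Real.pi / 2 * Complex.I by ring,
        Complex.exp_pi_div_two_mul_I]
    have e2 : Complex.exp (-pE / 2) = -Complex.I := by
      rw [neg_div, Complex.exp_neg, e1, Complex.inv_I]
    rw [e1, e2, pE] at this
    have e3 : Complex.I * (D pE * (2 * (Real.pi : ℂ))) = Complex.I * 1 := by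
      rw [pE]
      linear_combination -this
    exact mul_left_cancel₀ Complex.I_ne_zero e3

theorem ofReal_cpow_eq_exp {x : ℝ} (hx : 0 < x) (a : ℂ) :
    (x : ℂ) ^ a = Complex.exp (Real.log x * a) := by
  rw [Complex.cpow_def_of_ne_zero (by exact_mod_cast hx.ne'), Complex.ofReal_log hx.le]

theorem ofReal_mul_cpow {x : ℝ} (hx : 0 < x) {v : ℂ} (hv : v ≠ 0) (a : ℂ) :
    ((x : ℂ) * v) ^ a = (x : ℂ) ^ a * v ^ a := by
  have hx' : (x : ℂ) ≠ 0 := by exact_mod_cast hx.ne'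
  rw [Complex.cpow_def_of_ne_zero (mul_ne_zero hx' hv), Complex.log_ofReal_mul hx hv,
    ofReal_cpow_eq_exp hx, Complex.cpow_def_of_ne_zero hv, add_mul, Complex.exp_add]

theorem eventually_one_add_ne_zero (r : ℝ) : ∀ᶠ w : ℂ in 𝓝 0, 1 + w ^ 2 / (r : ℂ) ^ 2 ≠ 0 :=
  ContinuousAt.eventually_ne (by fun_prop) (by simp)

theorem continuousAt_log_one_add (r : ℝ) :
    ContinuousAt (fun w : ℂ => Complex.log (1 + w ^ 2 / (r : ℂ) ^ 2)) 0 :=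
  ContinuousAt.clog (by fun_prop) (by simp)

section

variable {r R : ℝ} (hr : 0 < r) (hrR : r < R) {D ℓ : ℂ → ℂ}
  (hD : Differentiable ℂ D) (hDne : ∀ w ∈ Metric.ball (0 : ℂ) R, D w ≠ 0)
  (hD0 : D (R * Complex.I) = 0) (hD' : deriv D (R * Complex.I) ≠ 0)
  (hℓ : ∀ w ∈ Metric.ball (0 : ℂ) R,
    HasDerivAt ℓ (deriv D w / D w) w ∧ Complex.exp (ℓ w) = D w / D 0 ∧ ℓ (-w) = ℓ w)
  {μ c κ b : ℂ} (hκ : κ ≠ 0) (hb : b ≠ 0) {Γ G : ℂ → ℂ}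
  (hΓ : Γ =ᶠ[𝓝 0] fun w => κ * Complex.exp (-μ * ℓ w + c * w))
  (hG : G =ᶠ[𝓝 0] fun w => binomFactor r (-μ) w * Complex.exp (-μ * ℓ w + c * w))
  {P : ℕ → ℂ} {Φ : ℕ → ℕ → ℂ} (hΦ : ∀ k n, Φ k n = b * expansionTerm r μ k n)
  (hP : ∀ N, P N * b = (N ! : ℂ) * κ⁻¹)

include hℓ in
theorem differentiableOn_exp_log :
    DifferentiableOn ℂ (fun w => κ * Complex.exp (-μ * ℓ w + c * w)) (Metric.ball 0 R) := by
  intro w hw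
  have := (hℓ w hw).1.differentiableAt
  exact DifferentiableAt.differentiableWithinAt (by fun_prop)

include hℓ hΓ in
theorem taylorContinuation_eq {w : ℂ} (hw : w ∈ Metric.ball (0 : ℂ) R) :
    taylorContinuation Γ w = κ * Complex.exp (-μ * ℓ w + c * w) :=
  taylorContinuation_eqOn hΓ (differentiableOn_exp_log hℓ) hw

include hℓ hΓ in
theorem differentiableOn_taylorContinuation :
    DifferentiableOn ℂ (taylorContinuation Γ) (Metric.ball 0 R) :=
  (differentiableOn_exp_log hℓ).congr fun _ hw => taylorContinuation_eq hℓ hΓ hw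

include hr hrR hℓ hΓ in
theorem taylorContinuation_eventuallyEq :
    AnalyticOnNhd ℂ (taylorContinuation Γ) (Metric.ball 0 R) ∧
      taylorContinuation Γ =ᶠ[𝓝 0] Γ := by
  refine ⟨(differentiableOn_taylorContinuation hℓ hΓ).analyticOnNhd Metric.isOpen_ball, ?_⟩
  filter_upwards [Metric.ball_mem_nhds (0 : ℂ) (hr.trans hrR), hΓ] with w h1 h2
  rw [taylorContinuation_eq hℓ hΓ h1, h2]

include hr hrR hℓ hΓ in
theorem hasSum_and_unique_taylorContinuation :
    (∀ᶠ w in 𝓝 ((r : ℂ) * Complex.I) ⊔ 𝓝 (-((r : ℂ) * Complex.I)),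
      HasSum (fun k : ℕ => (twoPointA (r * Complex.I) (taylorContinuation Γ) k +
        w * twoPointB (r * Complex.I) (taylorContinuation Γ) k) *
        ((w ^ 2 + (r : ℂ) ^ 2) / w ^ 2) ^ k) (taylorContinuation Γ w)) ∧
    ∀ a b : ℕ → ℂ,
      (∀ᶠ w in 𝓝 ((r : ℂ) * Complex.I) ⊔ 𝓝 (-((r : ℂ) * Complex.I)),
        HasSum (fun k : ℕ => (a k + w * b k) *
          ((w ^ 2 + (r : ℂ) ^ 2) / w ^ 2) ^ k) (taylorContinuation Γ w)) →
      a = twoPointA (r * Complex.I) (taylorContinuation Γ) ∧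
        b = twoPointB (r * Complex.I) (taylorContinuation Γ) := by
  have hp : (r : ℂ) * Complex.I ≠ 0 :=
    mul_ne_zero (by exact_mod_cast hr.ne') Complex.I_ne_zero
  have hpR : ‖(r : ℂ) * Complex.I‖ < R := by simpa [abs_of_pos hr] using hrR
  have hF := differentiableOn_taylorContinuation hℓ hΓ
  have hp2 : ∀ w : ℂ, w ^ 2 + (r : ℂ) ^ 2 = w ^ 2 - ((r : ℂ) * Complex.I) ^ 2 := fun w => by
    rw [mul_pow, Complex.I_sq]; ring
  simp only [hp2]
  exact ⟨eventually_hasSum_twoPoint hp hpR hF, fun a b h => twoPoint_unique hp hpR hF h⟩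

include hr hrR hℓ hκ hΓ hG hΦ hP in
theorem hasAsympExpansion_taylorContinuation :
    HasAsympExpansion (fun n => iteratedDeriv (2 * n) G 0)
      (twoPointA (r * Complex.I) (taylorContinuation Γ)) (fun k n => P (2 * n) * Φ k n)
      (fun k n => ((2 * n)! : ℂ) / (r : ℂ) ^ (2 * n) * (n : ℂ) ^ (μ - k - 1)) ∧
    HasAsympExpansion (fun n => iteratedDeriv (2 * n + 1) G 0)
      (twoPointB (r * Complex.I) (taylorContinuation Γ)) (fun k n => P (2 * n + 1) * Φ k n)
      (fun k n => ((2 * n + 1)! : ℂ) / (r : ℂ) ^ (2 * n) * (n : ℂ) ^ (μ - k - 1)) := by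
  have hF := differentiableOn_taylorContinuation hℓ hΓ
  have hG' : G =ᶠ[𝓝 0] fun w => κ⁻¹ * (taylorContinuation Γ w * binomFactor r (-μ) w) := by
    filter_upwards [Metric.ball_mem_nhds (0 : ℂ) (hr.trans hrR), hG] with w h1 h2
    rw [taylorContinuation_eq hℓ hΓ h1, h2]
    field_simp
  have hΦ' : ∀ N k n, P N * Φ k n = (N ! : ℂ) * κ⁻¹ * expansionTerm r μ k n := fun N k n => by
    rw [hΦ, ← mul_assoc, hP]
  exact ⟨hasAsympExpansion_even hr hrR hF hG' fun k n => hΦ' _ k n,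
    hasAsympExpansion_odd hr hrR hF hG' fun k n => hΦ' _ k n⟩

include hr hrR hℓ hκ hΓ hG hΦ hP hD hDne hD0 hD' hb in
theorem hasAsympExpansion_self_and_seriesDiverges (hμ : ∀ m : ℤ, μ ≠ m) :
    HasAsympExpansion (fun n => iteratedDeriv (2 * n) G 0)
      (twoPointA (r * Complex.I) (taylorContinuation Γ)) (fun k n => P (2 * n) * Φ k n)
      (fun k n => P (2 * n) * Φ k n) ∧
    HasAsympExpansion (fun n => iteratedDeriv (2 * n + 1) G 0)
      (twoPointB (r * Complex.I) (taylorContinuation Γ)) (fun k n => P (2 * n + 1) * Φ k n)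
      (fun k n => P (2 * n + 1) * Φ k n) ∧
    (∀ n, SeriesDiverges fun k =>
      twoPointA (r * Complex.I) (taylorContinuation Γ) k * Φ k n) ∧
    (c ≠ 0 → ∀ n, SeriesDiverges fun k =>
      twoPointB (r * Complex.I) (taylorContinuation Γ) k * Φ k n) := by
  have hF := differentiableOn_taylorContinuation hℓ hΓ
  obtain ⟨h1, h2⟩ := hasAsympExpansion_taylorContinuation hr hrR hℓ hκ hΓ hG hΦ hP
  have hΦ' : ∀ N k n, P N * Φ k n = (N ! : ℂ) * κ⁻¹ * expansionTerm r μ k n := fun N k n => by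
    rw [hΦ, ← mul_assoc, hP]
  have hSd : ∀ w ∈ Metric.ball (0 : ℂ) R,
      HasDerivAt (fun w => κ * Complex.exp (-μ * ℓ w))
        (κ * (Complex.exp (-μ * ℓ w) * (-μ * (deriv D w / D w)))) w := fun w hw =>
    (((hℓ w hw).1.const_mul (-μ)).cexp).const_mul κ
  have hS : DifferentiableOn ℂ (fun w => κ * Complex.exp (-μ * ℓ w)) (Metric.ball 0 R) :=
    fun w hw => (hSd w hw).differentiableAt.differentiableWithinAt
  have hS0 : ∀ w ∈ Metric.ball (0 : ℂ) R, κ * Complex.exp (-μ * ℓ w) ≠ 0 := fun w _ =>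
    mul_ne_zero hκ (Complex.exp_ne_zero _)
  have hSe : ∀ w ∈ Metric.ball (0 : ℂ) R,
      κ * Complex.exp (-μ * ℓ (-w)) = κ * Complex.exp (-μ * ℓ w) := fun w hw => by
    rw [(hℓ w hw).2.2]
  have hSD : ∀ w ∈ Metric.ball (0 : ℂ) R, deriv (fun w => κ * Complex.exp (-μ * ℓ w)) w * D w =
      -μ * (κ * Complex.exp (-μ * ℓ w)) * deriv D w := fun w hw => by
    rw [(hSd w hw).deriv]
    have := hDne w hw
    field_simp
  have hFS : ∀ w ∈ Metric.ball (0 : ℂ) R, taylorContinuation Γ w =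
      κ * Complex.exp (-μ * ℓ w) * Complex.exp (c * w) := fun w hw => by
    rw [taylorContinuation_eq hℓ hΓ hw, Complex.exp_add, mul_assoc]
  refine ⟨h1.of_isTheta fun k => ?_, h2.of_isTheta fun k => ?_, fun n => ?_, fun hc n => ?_⟩
  · exact isTheta_scale (ix := fun n => 2 * n) (t := fun k n => P (2 * n) * Φ k n)
      (inv_ne_zero hκ) hμ (fun k n => hΦ' _ k n) k
  · exact isTheta_scale (ix := fun n => 2 * n + 1) (t := fun k n => P (2 * n + 1) * Φ k n)
      (inv_ne_zero hκ) hμ (fun k n => hΦ' _ k n) k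
  · exact seriesDiverges_twoPointA hr hrR hμ hF hD hD0 hD' hS hS0 hSe hSD hFS n hb
      fun k => hΦ k n
  · exact seriesDiverges_twoPointB hr hrR hμ hF hD hD0 hD' hS hS0 hSe hSD hFS hc n hb
      fun k => hΦ k n

end

theorem ascPochhammer_div_factorial_eq_Gamma (μ : ℂ) (k n : ℕ) (h : ∀ j : ℕ, μ + n ≠ -(j : ℂ)) :
    (ascPochhammer ℂ (n + k)).eval (μ - k) / ((n + k)! : ℂ) =
      Complex.Gamma (μ + n) / (Complex.Gamma (μ - k) * ((n + k)! : ℂ)) := by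
  by_cases hs : ∀ j : ℕ, μ - k ≠ -j
  · rw [← Complex.Gamma_add_nat_div_Gamma_eq _ hs, div_div]
    congr 2
    push_cast; ring
  · push Not at hs
    obtain ⟨j, hj⟩ := hs
    have hlt : j < n + k := by
      by_contra hle
      refine h (j - (n + k)) ?_
      rw [Nat.cast_sub (by omega)]
      push_cast
      linear_combination hj
    rw [hj, Complex.Gamma_neg_nat_eq_zero, (ascPochhammer_eval_eq_zero_iff _ _).2 ⟨j, hlt, by simp⟩]
    simp

theorem expansionTerm_eq_zero_of_le (r : ℝ) {m k : ℕ} (hm : 0 < m) (hk : m ≤ k) (n : ℕ) :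
    expansionTerm r m k n = 0 := by
  rw [expansionTerm, (ascPochhammer_eval_eq_zero_iff _ _).2 ⟨k - m, by omega, by
    rw [Nat.cast_sub hk]; ring⟩]
  simp

theorem expansionTerm_eq_zero_of_lt (r : ℝ) {m n : ℕ} (hn : m < n) (k : ℕ) :
    expansionTerm r (-m) k n = 0 := by
  rw [expansionTerm, (ascPochhammer_eval_eq_zero_iff _ _).2 ⟨k + m, by omega, by
    push_cast; ring⟩]
  simp

theorem PhiT_eq (μ : ℂ) (k n : ℕ) : PhiT μ k n =
    ((2 * Real.pi : ℝ) : ℂ) ^ (-2 * μ) * expansionTerm (2 * Real.pi) μ k n := by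
  have hπ : (2 * (Real.pi : ℂ)) ≠ 0 := by simp [Real.pi_ne_zero]
  rw [PhiT, expansionTerm, Complex.cpow_sub _ _ hπ]
  push_cast
  rw [show (2 * (n : ℂ)) = ((2 * n : ℕ) : ℂ) by push_cast; ring, Complex.cpow_natCast]
  ring

theorem PsiT_eq (μ : ℂ) (k n : ℕ) : PsiT μ k n =
    (Real.pi : ℂ) ^ (-2 * μ) * expansionTerm Real.pi μ k n := by
  have hπ : (Real.pi : ℂ) ≠ 0 := by simp [Real.pi_ne_zero]
  rw [PsiT, expansionTerm, Complex.cpow_sub _ _ hπ]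
  rw [show (2 * (n : ℂ)) = ((2 * n : ℕ) : ℂ) by push_cast; ring, Complex.cpow_natCast]
  ring

/-- The constant `2^{-3μ} π^{-2μ} (4π²)^μ`. -/
def bernoulliConst (μ : ℂ) : ℂ :=
  (2 : ℂ) ^ (-3 * μ) * (Real.pi : ℂ) ^ (-2 * μ) * ((4 * Real.pi ^ 2 : ℝ) : ℂ) ^ μ

/-- The constant `(π/4)^μ`. -/
def eulerConst (μ : ℂ) : ℂ := ((Real.pi / 4 : ℝ) : ℂ) ^ μ

theorem bernoulliConst_eq_exp (μ : ℂ) : bernoulliConst μ = Complex.exp (-(Real.log 2 * μ)) := by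
  have h1 : (2 : ℂ) = ((2 : ℝ) : ℂ) := by norm_num
  have h2 : Real.log (4 * Real.pi ^ 2) = 2 * Real.log 2 + 2 * Real.log Real.pi := by
    rw [show (4 : ℝ) * Real.pi ^ 2 = 2 ^ 2 * Real.pi ^ 2 by norm_num,
      Real.log_mul (by norm_num) (pow_ne_zero _ Real.pi_ne_zero), Real.log_pow, Real.log_pow]
    norm_num
  rw [bernoulliConst, ofReal_cpow_eq_exp Real.pi_pos, ofReal_cpow_eq_exp (by positivity), h2]
  conv_lhs => rw [h1, ofReal_cpow_eq_exp two_pos]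
  rw [← Complex.exp_add, ← Complex.exp_add]
  congr 1
  push_cast
  ring

theorem bernoulliConst_ne_zero (μ : ℂ) : bernoulliConst μ ≠ 0 := by
  rw [bernoulliConst_eq_exp]
  exact Complex.exp_ne_zero _

theorem prefB_mul (μ : ℂ) (N : ℕ) : prefB μ N * ((2 * Real.pi : ℝ) : ℂ) ^ (-2 * μ) =
    (N ! : ℂ) * (bernoulliConst μ)⁻¹ := by
  have h1 : (2 : ℂ) ^ (3 * μ) = Complex.exp (Real.log 2 * (3 * μ)) := by
    rw [← ofReal_cpow_eq_exp two_pos]; norm_num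
  rw [prefB, bernoulliConst_eq_exp, ← Complex.exp_neg, h1, ofReal_cpow_eq_exp Real.pi_pos,
    ofReal_cpow_eq_exp (by positivity), Real.log_mul two_ne_zero Real.pi_ne_zero, mul_assoc,
    mul_assoc, ← Complex.exp_add, ← Complex.exp_add]
  congr 2
  push_cast
  ring

theorem eulerConst_ne_zero (μ : ℂ) : eulerConst μ ≠ 0 := by
  rw [eulerConst, ofReal_cpow_eq_exp (by positivity)]
  exact Complex.exp_ne_zero _

theorem prefE_mul (μ : ℂ) (N : ℕ) : prefE μ N * (Real.pi : ℂ) ^ (-2 * μ) =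
    (N ! : ℂ) * (eulerConst μ)⁻¹ := by
  have h1 : (4 * (Real.pi : ℂ)) ^ μ = Complex.exp (Real.log (4 * Real.pi) * μ) := by
    rw [← ofReal_cpow_eq_exp (by positivity)]; norm_num
  rw [prefE, eulerConst, h1, ofReal_cpow_eq_exp Real.pi_pos,
    ofReal_cpow_eq_exp (by positivity), ← Complex.exp_neg,
    Real.log_mul (by norm_num) Real.pi_ne_zero, Real.log_div Real.pi_ne_zero (by norm_num),
    mul_assoc, ← Complex.exp_add]
  congr 2
  push_cast
  ring

theorem binomFactor_eq_exp {r : ℝ} (ν : ℂ) {w : ℂ} (hw : 1 + w ^ 2 / (r : ℂ) ^ 2 ≠ 0) :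
    binomFactor r ν w = Complex.exp (Complex.log (1 + w ^ 2 / (r : ℂ) ^ 2) * ν) := by
  rw [binomFactor, Complex.cpow_def_of_ne_zero hw]

section

variable {D ℓ : ℂ → ℂ}

theorem log_bernoulliBase (hℓ0 : ℓ 0 = 0)
    (hD : ∀ w, Complex.exp w - 1 =
      Complex.exp (w / 2) * (w * (w ^ 2 + 4 * (Real.pi : ℂ) ^ 2) * D w))
    (hD0 : D 0 * (4 * (Real.pi : ℂ) ^ 2) = 1) (hDc : ContinuousAt D 0) (hℓc : ContinuousAt ℓ 0)
    (hℓ : ∀ᶠ w in 𝓝 0, Complex.exp (ℓ w) = D w / D 0) :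
    ∀ᶠ w in 𝓝 (0 : ℂ), bernoulliBase w ≠ 0 ∧ Complex.log (bernoulliBase w) =
      -w / 2 - ℓ w - Complex.log (1 + w ^ 2 / ((2 * Real.pi : ℝ) : ℂ) ^ 2) := by
  have hπ : (Real.pi : ℂ) ≠ 0 := by simp [Real.pi_ne_zero]
  have hD00 : D 0 ≠ 0 := left_ne_zero_of_mul_eq_one hD0
  have hbase : ∀ᶠ w in 𝓝 (0 : ℂ), bernoulliBase w =
      Complex.exp (-w / 2 - ℓ w - Complex.log (1 + w ^ 2 / ((2 * Real.pi : ℝ) : ℂ) ^ 2)) := by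
    filter_upwards [hDc.eventually_ne hD00, hℓ, eventually_one_add_ne_zero (2 * Real.pi)]
      with w h1 h2 h3
    have h4 : (w ^ 2 + 4 * (Real.pi : ℂ) ^ 2) =
        4 * (Real.pi : ℂ) ^ 2 * (1 + w ^ 2 / ((2 * Real.pi : ℝ) : ℂ) ^ 2) := by
      push_cast; field_simp; ring
    rw [Complex.exp_sub, Complex.exp_sub, h2, Complex.exp_log h3, neg_div, Complex.exp_neg]
    have h5 := Complex.exp_ne_zero (w / 2)
    rw [bernoulliBase]
    split_ifs with hw
    · subst hw
      simp [hD00]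
    · rw [hD, h4]
      set v := 1 + w ^ 2 / ((2 * Real.pi : ℝ) : ℂ) ^ 2
      have h6 : D 0 = 1 / (4 * (Real.pi : ℂ) ^ 2) := by
        rw [eq_div_iff (by simp [hπ])]; exact hD0
      rw [h6]
      field_simp
  have hlogc := continuousAt_log_one_add (2 * Real.pi)
  have hYc : ContinuousAt (fun w => -w / 2 - ℓ w -
      Complex.log (1 + w ^ 2 / ((2 * Real.pi : ℝ) : ℂ) ^ 2)) 0 :=
    ((by fun_prop : ContinuousAt (fun w : ℂ => -w / 2) 0).sub hℓc).sub hlogc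
  have hne : ∀ᶠ w in 𝓝 (0 : ℂ), bernoulliBase w ≠ 0 := by
    filter_upwards [hbase] with w hw
    rw [hw]; exact Complex.exp_ne_zero _
  have hbc : ContinuousAt bernoulliBase 0 :=
    (hYc.cexp).congr (hbase.mono fun w hw => hw.symm)
  have hb0 : bernoulliBase 0 = 1 := by simp [bernoulliBase]
  have := eventuallyEq_of_exp_eq (hbc.clog (by simp [hb0])) hYc (by simp [hb0, hℓ0]) (by
    filter_upwards [hne, hbase] with w h1 h2
    rw [Complex.exp_log h1, h2])
  filter_upwards [hne, this] with w h1 h2 using ⟨h1, h2⟩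

theorem log_exp_add_one (hℓ0 : ℓ 0 = 0)
    (hD : ∀ w, Complex.exp w + 1 = Complex.exp (w / 2) * ((w ^ 2 + (Real.pi : ℂ) ^ 2) * D w))
    (hD0 : D 0 * (Real.pi : ℂ) ^ 2 = 2) (hℓc : ContinuousAt ℓ 0)
    (hℓ : ∀ᶠ w in 𝓝 0, Complex.exp (ℓ w) = D w / D 0) :
    ∀ᶠ w in 𝓝 (0 : ℂ), Complex.exp w + 1 ≠ 0 ∧ Complex.log (Complex.exp w + 1) =
      Real.log 2 + w / 2 + ℓ w + Complex.log (1 + w ^ 2 / (Real.pi : ℂ) ^ 2) ∧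
      Complex.log (1 / (Complex.exp w + 1)) = -Complex.log (Complex.exp w + 1) := by
  have hπ : (Real.pi : ℂ) ≠ 0 := by simp [Real.pi_ne_zero]
  have hD00 : D 0 ≠ 0 := fun h => by rw [h] at hD0; norm_num at hD0
  have hl2 : Complex.exp (Real.log 2 : ℂ) = 2 := by
    rw [← Complex.ofReal_exp, Real.exp_log two_pos]; norm_num
  have hbase : ∀ᶠ w in 𝓝 (0 : ℂ), Complex.exp w + 1 =
      Complex.exp (Real.log 2 + w / 2 + ℓ w + Complex.log (1 + w ^ 2 / (Real.pi : ℂ) ^ 2)) := by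
    filter_upwards [hℓ, eventually_one_add_ne_zero Real.pi] with w h2 h3
    rw [Complex.exp_add, Complex.exp_add, Complex.exp_add, h2, Complex.exp_log h3, hl2, hD, ← hD0]
    field_simp
    ring
  have hlogc := continuousAt_log_one_add Real.pi
  have hYc : ContinuousAt (fun w => (Real.log 2 : ℂ) + w / 2 + ℓ w +
      Complex.log (1 + w ^ 2 / (Real.pi : ℂ) ^ 2)) 0 :=
    ((by fun_prop : ContinuousAt (fun w : ℂ => (Real.log 2 : ℂ) + w / 2) 0).add hℓc).add hlogc
  have hne : ∀ᶠ w in 𝓝 (0 : ℂ), Complex.exp w + 1 ≠ 0 := by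
    filter_upwards [hbase] with w hw
    rw [hw]; exact Complex.exp_ne_zero _
  have h11 : Complex.exp 0 + 1 = ((2 : ℝ) : ℂ) := by norm_num
  have hXc : ContinuousAt (fun w => Complex.log (Complex.exp w + 1)) 0 :=
    ContinuousAt.clog (by fun_prop) (by rw [h11]; simp)
  have e1 := eventuallyEq_of_exp_eq hXc hYc (by simp [hℓ0]; norm_num) (by
    filter_upwards [hne, hbase] with w h1 h2
    rw [Complex.exp_log h1, h2])
  have hZc : ContinuousAt (fun w => Complex.log (1 / (Complex.exp w + 1))) 0 := by
    refine ContinuousAt.clog (ContinuousAt.div (by fun_prop) (by fun_prop) hne.self_of_nhds) ?_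
    rw [h11, ← Complex.ofReal_one, ← Complex.ofReal_div, Complex.ofReal_mem_slitPlane]
    norm_num
  have e2 := eventuallyEq_of_exp_eq hZc hXc.neg (by
    have : (1 : ℂ) / (Complex.exp 0 + 1) = ((1 / 2 : ℝ) : ℂ) := by rw [h11]; norm_num
    rw [this, Pi.neg_apply, h11, ← Complex.ofReal_log (by norm_num),
      ← Complex.ofReal_log (by norm_num), one_div, Real.log_inv]
    norm_num) (by
    filter_upwards [hne] with w h1
    rw [Pi.neg_apply, Complex.exp_neg, Complex.exp_log h1,
      Complex.exp_log (one_div_ne_zero h1), one_div])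
  filter_upwards [hne, e1, e2] with w h1 h2 h3 using ⟨h1, h2, h3⟩

end

theorem pB_eq : pB = ((2 * Real.pi : ℝ) : ℂ) * Complex.I := by simp [pB]

theorem pE_eq : pE = ((Real.pi : ℝ) : ℂ) * Complex.I := rfl

theorem binomFactor_mul_neg {r : ℝ} (ν : ℂ) {w : ℂ} (hw : 1 + w ^ 2 / (r : ℂ) ^ 2 ≠ 0) :
    binomFactor r ν w * binomFactor r (-ν) w = 1 := by
  rw [binomFactor_eq_exp _ hw, binomFactor_eq_exp _ hw, ← Complex.exp_add]
  simp

theorem interpAB_of_eq_exp {p : ℂ} {F : ℂ → ℂ} {κ a θ : ℂ} (h1 : F p = κ * a * Complex.exp θ)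
    (h2 : F (-p) = κ * a * Complex.exp (-θ)) :
    interpA p F = κ * a * Complex.cosh θ ∧ interpB p F = κ * a * Complex.sinh θ / p := by
  rw [interpA, interpB, h1, h2, Complex.cosh, Complex.sinh]
  constructor <;> ring

section

variable {ℓ : ℂ → ℂ}

theorem bernoulli_germs
    (h : ∀ᶠ w in 𝓝 (0 : ℂ), bernoulliBase w ≠ 0 ∧ Complex.log (bernoulliBase w) =
      -w / 2 - ℓ w - Complex.log (1 + w ^ 2 / ((2 * Real.pi : ℝ) : ℂ) ^ 2)) (μ z : ℂ) :
    (fGerm μ z =ᶠ[𝓝 0] fun w =>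
      bernoulliConst μ * Complex.exp (-μ * ℓ w + (z - μ / 2) * w)) ∧
    (fun w : ℂ => bernoulliBase w ^ μ * Complex.exp (w * z)) =ᶠ[𝓝 0] fun w =>
      binomFactor (2 * Real.pi) (-μ) w * Complex.exp (-μ * ℓ w + (z - μ / 2) * w) := by
  have hπ : (Real.pi : ℂ) ≠ 0 := by simp [Real.pi_ne_zero]
  have key : ∀ᶠ w in 𝓝 (0 : ℂ), bernoulliBase w ^ μ * Complex.exp (w * z) =
      binomFactor (2 * Real.pi) (-μ) w * Complex.exp (-μ * ℓ w + (z - μ / 2) * w) := by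
    filter_upwards [h, eventually_one_add_ne_zero (2 * Real.pi)] with w ⟨h1, h2⟩ h3
    rw [Complex.cpow_def_of_ne_zero h1, h2, binomFactor_eq_exp _ h3, ← Complex.exp_add,
      ← Complex.exp_add]
    congr 1
    ring
  refine ⟨?_, key⟩
  filter_upwards [key, eventually_one_add_ne_zero (2 * Real.pi)] with w h1 h3
  have h4 : w ^ 2 + 4 * (Real.pi : ℂ) ^ 2 =
      ((4 * Real.pi ^ 2 : ℝ) : ℂ) * (1 + w ^ 2 / ((2 * Real.pi : ℝ) : ℂ) ^ 2) := by
    push_cast; field_simp; ring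
  have h5 : (w ^ 2 + 4 * (Real.pi : ℂ) ^ 2) ^ μ =
      ((4 * Real.pi ^ 2 : ℝ) : ℂ) ^ μ * binomFactor (2 * Real.pi) μ w := by
    rw [h4, ofReal_mul_cpow (by positivity) h3, binomFactor]
  have h6 := binomFactor_mul_neg μ h3
  rw [fGerm, mul_assoc _ (bernoulliBase w ^ μ), h1, h5, bernoulliConst]
  linear_combination ((2 : ℂ) ^ (-3 * μ) * (Real.pi : ℂ) ^ (-2 * μ) *
    ((4 * Real.pi ^ 2 : ℝ) : ℂ) ^ μ * Complex.exp (-μ * ℓ w + (z - μ / 2) * w)) * h6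

theorem euler_germs
    (h : ∀ᶠ w in 𝓝 (0 : ℂ), Complex.exp w + 1 ≠ 0 ∧ Complex.log (Complex.exp w + 1) =
      Real.log 2 + w / 2 + ℓ w + Complex.log (1 + w ^ 2 / (Real.pi : ℂ) ^ 2) ∧
      Complex.log (1 / (Complex.exp w + 1)) = -Complex.log (Complex.exp w + 1)) (μ z : ℂ) :
    (gGerm μ z =ᶠ[𝓝 0] fun w =>
      eulerConst μ * Complex.exp (-μ * ℓ w + (z - μ / 2) * w)) ∧
    (fun w : ℂ => (2 : ℂ) ^ μ * Complex.exp (w * z) / (Complex.exp w + 1) ^ μ) =ᶠ[𝓝 0] fun w =>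
      binomFactor Real.pi (-μ) w * Complex.exp (-μ * ℓ w + (z - μ / 2) * w) := by
  have hπ : (Real.pi : ℂ) ≠ 0 := by simp [Real.pi_ne_zero]
  have h2μ : (2 : ℂ) ^ μ = Complex.exp (Real.log 2 * μ) := by
    rw [← ofReal_cpow_eq_exp two_pos]; norm_num
  constructor
  · filter_upwards [h, eventually_one_add_ne_zero Real.pi] with w ⟨h1, h2, h2'⟩ h3
    have h4 : (w ^ 2 + (Real.pi : ℂ) ^ 2) / (2 * (Real.pi : ℂ)) =
        ((Real.pi / 2 : ℝ) : ℂ) * (1 + w ^ 2 / (Real.pi : ℂ) ^ 2) := by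
      push_cast; field_simp; ring
    rw [gGerm, h4, ofReal_mul_cpow (by positivity) h3, Complex.cpow_def_of_ne_zero h3,
      Complex.cpow_def_of_ne_zero (one_div_ne_zero h1), h2', h2, eulerConst,
      ofReal_cpow_eq_exp (by positivity), ofReal_cpow_eq_exp (by positivity),
      Real.log_div Real.pi_ne_zero two_ne_zero, Real.log_div Real.pi_ne_zero (by norm_num),
      show (4 : ℝ) = 2 ^ 2 by norm_num, Real.log_pow]
    simp only [← Complex.exp_add]
    congr 1
    push_cast
    ring
  · filter_upwards [h, eventually_one_add_ne_zero Real.pi] with w ⟨h1, h2, _⟩ h3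
    rw [h2μ, Complex.cpow_def_of_ne_zero h1, h2, binomFactor_eq_exp _ h3, div_eq_mul_inv,
      ← Complex.exp_neg]
    simp only [← Complex.exp_add]
    congr 1
    ring

end

theorem bernoulli_interp_of_eq_one {D ℓ : ℂ → ℂ} {z : ℂ} (hDe : ∀ w, D (-w) = D w)
    (hD0 : D 0 * (4 * (Real.pi : ℂ) ^ 2) = 1) (hDp : D pB * (8 * (Real.pi : ℂ) ^ 2) = 1)
    (hℓ : ∀ w ∈ Metric.ball (0 : ℂ) (4 * Real.pi), Complex.exp (ℓ w) = D w / D 0)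
    (hf : ∀ w ∈ Metric.ball (0 : ℂ) (4 * Real.pi),
      f 1 z w = bernoulliConst 1 * Complex.exp (-1 * ℓ w + (z - 1 / 2) * w)) :
    alphaT 1 z 0 = -Complex.cos (2 * Real.pi * z) ∧
      betaT 1 z 0 = -Complex.sin (2 * Real.pi * z) / (2 * Real.pi) := by
  have hπ : (Real.pi : ℂ) ≠ 0 := by simp [Real.pi_ne_zero]
  have hκ : bernoulliConst 1 = 1 / 2 := by
    rw [bernoulliConst_eq_exp, mul_one, Complex.exp_neg, ← Complex.ofReal_exp,
      Real.exp_log two_pos]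
    norm_num
  have hnorm : ‖pB‖ < 4 * Real.pi := by
    rw [pB_eq, norm_mul, Complex.norm_I, mul_one, Complex.norm_real,
      Real.norm_of_nonneg (by positivity)]
    linarith [Real.pi_pos]
  have hpm : pB ∈ Metric.ball (0 : ℂ) (4 * Real.pi) := by simpa using hnorm
  have hmm : -pB ∈ Metric.ball (0 : ℂ) (4 * Real.pi) := by simpa using hnorm
  have e1 : D pB / D 0 = 1 / 2 := by
    have h0 : D 0 = 1 / (4 * (Real.pi : ℂ) ^ 2) := by
      rw [eq_div_iff (by simp [hπ])]; exact hD0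
    have h1 : D pB = 1 / (8 * (Real.pi : ℂ) ^ 2) := by
      rw [eq_div_iff (by simp [hπ])]; exact hDp
    rw [h0, h1]; field_simp; norm_num
  have h1 : f 1 z pB = 1 / 2 * 2 * Complex.exp ((z - 1 / 2) * pB) := by
    rw [hf _ hpm, hκ, Complex.exp_add, neg_one_mul, Complex.exp_neg, hℓ _ hpm, e1]
    ring
  have h2 : f 1 z (-pB) = 1 / 2 * 2 * Complex.exp (-((z - 1 / 2) * pB)) := by
    rw [hf _ hmm, hκ, Complex.exp_add, neg_one_mul, Complex.exp_neg, hℓ _ hmm, hDe, e1, mul_neg]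
    ring
  obtain ⟨hA, hB⟩ := interpAB_of_eq_exp h1 h2
  have hθ : (z - 1 / 2) * pB = (2 * Real.pi * z - Real.pi) * Complex.I := by rw [pB]; ring
  rw [hθ] at hA hB
  constructor
  · change interpA pB (f 1 z) = _
    rw [hA, Complex.cosh_mul_I, Complex.cos_sub_pi]; ring
  · change interpB pB (f 1 z) = _
    rw [hB, Complex.sinh_mul_I, Complex.sin_sub_pi, pB]
    have := Complex.I_ne_zero
    field_simp

theorem euler_interp_of_eq_one {D ℓ : ℂ → ℂ} {z : ℂ} (hDe : ∀ w, D (-w) = D w)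
    (hD0 : D 0 * (Real.pi : ℂ) ^ 2 = 2) (hDp : D pE * (2 * (Real.pi : ℂ)) = 1)
    (hℓ : ∀ w ∈ Metric.ball (0 : ℂ) (3 * Real.pi), Complex.exp (ℓ w) = D w / D 0)
    (hg : ∀ w ∈ Metric.ball (0 : ℂ) (3 * Real.pi),
      g 1 z w = eulerConst 1 * Complex.exp (-1 * ℓ w + (z - 1 / 2) * w)) :
    gammaT 1 z 0 = Complex.sin (Real.pi * z) ∧
      deltaT 1 z 0 = -Complex.cos (Real.pi * z) / Real.pi := by
  have hπ : (Real.pi : ℂ) ≠ 0 := by simp [Real.pi_ne_zero]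
  have hκ : eulerConst 1 = Real.pi / 4 := by
    rw [eulerConst, Complex.cpow_one]; push_cast; rfl
  have hnorm : ‖pE‖ < 3 * Real.pi := by
    rw [pE_eq, norm_mul, Complex.norm_I, mul_one, Complex.norm_real,
      Real.norm_of_nonneg (by positivity)]
    linarith [Real.pi_pos]
  have hpm : pE ∈ Metric.ball (0 : ℂ) (3 * Real.pi) := by simpa using hnorm
  have hmm : -pE ∈ Metric.ball (0 : ℂ) (3 * Real.pi) := by simpa using hnorm
  have e1 : D pE / D 0 = Real.pi / 4 := by
    have h0 : D 0 = 2 / (Real.pi : ℂ) ^ 2 := by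
      rw [eq_div_iff (by simp [hπ])]; exact hD0
    have h1 : D pE = 1 / (2 * (Real.pi : ℂ)) := by
      rw [eq_div_iff (by simp [hπ])]; exact hDp
    rw [h0, h1]; field_simp; norm_num
  have h1 : g 1 z pE = Real.pi / 4 * (4 / Real.pi) * Complex.exp ((z - 1 / 2) * pE) := by
    rw [hg _ hpm, hκ, Complex.exp_add, neg_one_mul, Complex.exp_neg, hℓ _ hpm, e1]
    field_simp
  have h2 : g 1 z (-pE) = Real.pi / 4 * (4 / Real.pi) * Complex.exp (-((z - 1 / 2) * pE)) := by
    rw [hg _ hmm, hκ, Complex.exp_add, neg_one_mul, Complex.exp_neg, hℓ _ hmm, hDe, e1, mul_neg]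
    field_simp
  obtain ⟨hA, hB⟩ := interpAB_of_eq_exp h1 h2
  have hθ : (z - 1 / 2) * pE = (Real.pi * z - Real.pi / 2) * Complex.I := by rw [pE]; ring
  rw [hθ] at hA hB
  constructor
  · change interpA pE (g 1 z) = _
    rw [hA, Complex.cosh_mul_I, Complex.cos_sub_pi_div_two]
    field_simp
  · change interpB pE (g 1 z) = _
    rw [hB, Complex.sinh_mul_I, Complex.sin_sub_pi_div_two, pE]
    have := Complex.I_ne_zero
    field_simp

theorem sum_range_eq_first {a t : ℕ → ℂ} (ht : ∀ k, 1 ≤ k → t k = 0) {N : ℕ} (hN : 1 ≤ N) :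
    ∑ k ∈ Finset.range N, a k * t k = a 0 * t 0 :=
  Finset.sum_eq_single_of_mem 0 (Finset.mem_range.2 hN) fun k _ hk => by
    rw [ht k (Nat.one_le_iff_ne_zero.2 hk), mul_zero]

theorem ascPochhammer_eval_one (n : ℕ) : (ascPochhammer ℂ n).eval 1 = (n ! : ℂ) := by
  simp

theorem PhiT_one_zero (n : ℕ) : PhiT 1 0 n = (-1) ^ n / (2 * (Real.pi : ℂ)) ^ (2 * n + 2) := by
  have hn : (n ! : ℂ) ≠ 0 := by exact_mod_cast n.factorial_ne_zero
  rw [PhiT, Nat.cast_zero, sub_zero, add_zero, ascPochhammer_eval_one, mul_div_assoc, div_self hn,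
    mul_one, show (-2 * 1 - 2 * (n : ℂ)) = -((2 * n + 2 : ℕ) : ℂ) by push_cast; ring,
    Complex.cpow_neg, Complex.cpow_natCast, div_eq_mul_inv]

theorem PsiT_one_zero (n : ℕ) : PsiT 1 0 n = (-1) ^ n / (Real.pi : ℂ) ^ (2 * n + 2) := by
  have hn : (n ! : ℂ) ≠ 0 := by exact_mod_cast n.factorial_ne_zero
  rw [PsiT, Nat.cast_zero, sub_zero, add_zero, ascPochhammer_eval_one, mul_div_assoc, div_self hn,
    mul_one, show (-2 * 1 - 2 * (n : ℂ)) = -((2 * n + 2 : ℕ) : ℂ) by push_cast; ring,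
    Complex.cpow_neg, Complex.cpow_natCast, div_eq_mul_inv]

theorem prefB_one (N : ℕ) : prefB 1 N = (N ! : ℂ) * 8 * (Real.pi : ℂ) ^ 2 := by
  have h1 : (2 : ℂ) ^ (3 * 1 : ℂ) = 8 := by
    rw [mul_one, show (3 : ℂ) = ((3 : ℕ) : ℂ) by norm_num, Complex.cpow_natCast]; norm_num
  have h2 : (Real.pi : ℂ) ^ (2 * 1 : ℂ) = (Real.pi : ℂ) ^ 2 := by
    rw [mul_one, show (2 : ℂ) = ((2 : ℕ) : ℂ) by norm_num, Complex.cpow_natCast]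
  rw [prefB, h1, h2]

theorem prefE_one (N : ℕ) : prefE 1 N = (N ! : ℂ) * (4 * (Real.pi : ℂ)) := by
  rw [prefE, Complex.cpow_one]

theorem bernoulli_expansion (μ z : ℂ) :
    (AnalyticOnNhd ℂ (f μ z) (Metric.ball 0 (4 * Real.pi)) ∧ f μ z =ᶠ[𝓝 0] fGerm μ z) ∧
    (∀ᶠ w in 𝓝 (2 * (Real.pi : ℂ) * Complex.I) ⊔ 𝓝 (-(2 * (Real.pi : ℂ) * Complex.I)),
      HasSum (fun k : ℕ => (alphaT μ z k + w * betaT μ z k) *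
        ((w ^ 2 + 4 * (Real.pi : ℂ) ^ 2) / w ^ 2) ^ k) (f μ z w)) ∧
    (∀ a b : ℕ → ℂ,
      (∀ᶠ w in 𝓝 (2 * (Real.pi : ℂ) * Complex.I) ⊔ 𝓝 (-(2 * (Real.pi : ℂ) * Complex.I)),
        HasSum (fun k : ℕ => (a k + w * b k) *
          ((w ^ 2 + 4 * (Real.pi : ℂ) ^ 2) / w ^ 2) ^ k) (f μ z w)) →
      a = alphaT μ z ∧ b = betaT μ z) ∧
    HasAsympExpansion (fun n => genBernoulli μ (2 * n) z) (alphaT μ z)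
      (fun k n => prefB μ (2 * n) * PhiT μ k n)
      (fun k n => ((2 * n)! : ℂ) / (2 * (Real.pi : ℂ)) ^ (2 * n) * (n : ℂ) ^ (μ - k - 1)) ∧
    HasAsympExpansion (fun n => genBernoulli μ (2 * n + 1) z) (betaT μ z)
      (fun k n => prefB μ (2 * n + 1) * PhiT μ k n)
      (fun k n => ((2 * n + 1)! : ℂ) / (2 * (Real.pi : ℂ)) ^ (2 * n) *
        (n : ℂ) ^ (μ - k - 1)) ∧
    ((∀ m : ℤ, μ ≠ m) →
      HasAsympExpansion (fun n => genBernoulli μ (2 * n) z) (alphaT μ z)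
        (fun k n => prefB μ (2 * n) * PhiT μ k n)
        (fun k n => prefB μ (2 * n) * PhiT μ k n) ∧
      HasAsympExpansion (fun n => genBernoulli μ (2 * n + 1) z) (betaT μ z)
        (fun k n => prefB μ (2 * n + 1) * PhiT μ k n)
        (fun k n => prefB μ (2 * n + 1) * PhiT μ k n) ∧
      (∀ n : ℕ, SeriesDiverges (fun k => alphaT μ z k * PhiT μ k n)) ∧
      (z ≠ μ / 2 → ∀ n : ℕ, SeriesDiverges (fun k => betaT μ z k * PhiT μ k n))) ∧
    (μ = 1 → alphaT μ z 0 = -Complex.cos (2 * Real.pi * z) ∧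
      betaT μ z 0 = -Complex.sin (2 * Real.pi * z) / (2 * Real.pi)) := by
  have hr : (0 : ℝ) < 2 * Real.pi := by positivity
  have hrR : 2 * Real.pi < 4 * Real.pi := by linarith [Real.pi_pos]
  obtain ⟨D, hD, hDe, hDq, hDne, hDz, hDz', hD0, hDp⟩ := exists_bernoulliFactor
  obtain ⟨ℓ, hℓ0, hℓ⟩ := exists_even_log hD hDe hDne
  have h0 : Metric.ball (0 : ℂ) (4 * Real.pi) ∈ 𝓝 0 := Metric.ball_mem_nhds _ (hr.trans hrR)
  have hlog := log_bernoulliBase hℓ0 hDq hD0 (hD 0).continuousAt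
    (hℓ 0 (mem_of_mem_nhds h0)).1.continuousAt
    (by filter_upwards [h0] with w hw using (hℓ w hw).2.1)
  obtain ⟨hΓ, hG⟩ := bernoulli_germs hlog μ z
  have hκ := bernoulliConst_ne_zero μ
  have hb : ((2 * Real.pi : ℝ) : ℂ) ^ (-2 * μ) ≠ 0 := by
    rw [ofReal_cpow_eq_exp hr]; exact Complex.exp_ne_zero _
  have c1 := taylorContinuation_eventuallyEq hr hrR hℓ hΓ
  have c2 := hasSum_and_unique_taylorContinuation hr hrR hℓ hΓ
  have c3 := hasAsympExpansion_taylorContinuation hr hrR hℓ hκ hΓ hG (PhiT_eq μ) (prefB_mul μ)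
  have c4 := hasAsympExpansion_self_and_seriesDiverges hr hrR hD hDne hDz hDz' hℓ hκ hb hΓ hG
    (PhiT_eq μ) (prefB_mul μ)
  rw [← pB_eq] at c2 c3 c4
  have hsq : ((2 * Real.pi : ℝ) : ℂ) ^ 2 = 4 * (Real.pi : ℂ) ^ 2 := by push_cast; ring
  have hcast : ((2 * Real.pi : ℝ) : ℂ) = 2 * (Real.pi : ℂ) := by push_cast; rfl
  rw [hsq] at c2
  rw [hcast] at c3
  refine ⟨c1, c2.1, c2.2, c3.1, c3.2, fun hμ => ?_, ?_⟩
  · obtain ⟨d1, d2, d3, d4⟩ := c4 hμ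
    exact ⟨d1, d2, d3, fun hz => d4 (sub_ne_zero.2 hz)⟩
  · rintro rfl
    exact bernoulli_interp_of_eq_one hDe hD0 hDp (fun w hw => (hℓ w hw).2.1)
      fun w hw => taylorContinuation_eq hℓ hΓ hw

theorem euler_expansion (μ z : ℂ) :
    (AnalyticOnNhd ℂ (g μ z) (Metric.ball 0 (3 * Real.pi)) ∧ g μ z =ᶠ[𝓝 0] gGerm μ z) ∧
    (∀ᶠ w in 𝓝 ((Real.pi : ℂ) * Complex.I) ⊔ 𝓝 (-((Real.pi : ℂ) * Complex.I)),
      HasSum (fun k : ℕ => (gammaT μ z k + w * deltaT μ z k) *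
        ((w ^ 2 + (Real.pi : ℂ) ^ 2) / w ^ 2) ^ k) (g μ z w)) ∧
    (∀ a b : ℕ → ℂ,
      (∀ᶠ w in 𝓝 ((Real.pi : ℂ) * Complex.I) ⊔ 𝓝 (-((Real.pi : ℂ) * Complex.I)),
        HasSum (fun k : ℕ => (a k + w * b k) *
          ((w ^ 2 + (Real.pi : ℂ) ^ 2) / w ^ 2) ^ k) (g μ z w)) →
      a = gammaT μ z ∧ b = deltaT μ z) ∧
    HasAsympExpansion (fun n => genEuler μ (2 * n) z) (gammaT μ z)
      (fun k n => prefE μ (2 * n) * PsiT μ k n)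
      (fun k n => ((2 * n)! : ℂ) / (Real.pi : ℂ) ^ (2 * n) * (n : ℂ) ^ (μ - k - 1)) ∧
    HasAsympExpansion (fun n => genEuler μ (2 * n + 1) z) (deltaT μ z)
      (fun k n => prefE μ (2 * n + 1) * PsiT μ k n)
      (fun k n => ((2 * n + 1)! : ℂ) / (Real.pi : ℂ) ^ (2 * n) * (n : ℂ) ^ (μ - k - 1)) ∧
    ((∀ m : ℤ, μ ≠ m) →
      HasAsympExpansion (fun n => genEuler μ (2 * n) z) (gammaT μ z)
        (fun k n => prefE μ (2 * n) * PsiT μ k n)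
        (fun k n => prefE μ (2 * n) * PsiT μ k n) ∧
      HasAsympExpansion (fun n => genEuler μ (2 * n + 1) z) (deltaT μ z)
        (fun k n => prefE μ (2 * n + 1) * PsiT μ k n)
        (fun k n => prefE μ (2 * n + 1) * PsiT μ k n) ∧
      (∀ n : ℕ, SeriesDiverges (fun k => gammaT μ z k * PsiT μ k n)) ∧
      (z ≠ μ / 2 → ∀ n : ℕ, SeriesDiverges (fun k => deltaT μ z k * PsiT μ k n))) ∧
    (μ = 1 → gammaT μ z 0 = Complex.sin (Real.pi * z) ∧
      deltaT μ z 0 = -Complex.cos (Real.pi * z) / Real.pi) := by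
  have hr := Real.pi_pos
  have hrR : Real.pi < 3 * Real.pi := by linarith [Real.pi_pos]
  obtain ⟨D, hD, hDe, hDq, hDne, hDz, hDz', hD0, hDp⟩ := exists_eulerFactor
  obtain ⟨ℓ, hℓ0, hℓ⟩ := exists_even_log hD hDe hDne
  have h0 : Metric.ball (0 : ℂ) (3 * Real.pi) ∈ 𝓝 0 := Metric.ball_mem_nhds _ (hr.trans hrR)
  have hlog := log_exp_add_one hℓ0 hDq hD0
    (hℓ 0 (mem_of_mem_nhds h0)).1.continuousAt
    (by filter_upwards [h0] with w hw using (hℓ w hw).2.1)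
  obtain ⟨hΓ, hG⟩ := euler_germs hlog μ z
  have hκ := eulerConst_ne_zero μ
  have hb : (Real.pi : ℂ) ^ (-2 * μ) ≠ 0 := by
    rw [ofReal_cpow_eq_exp hr]; exact Complex.exp_ne_zero _
  have c1 := taylorContinuation_eventuallyEq hr hrR hℓ hΓ
  have c2 := hasSum_and_unique_taylorContinuation hr hrR hℓ hΓ
  have c3 := hasAsympExpansion_taylorContinuation hr hrR hℓ hκ hΓ hG (PsiT_eq μ) (prefE_mul μ)
  have c4 := hasAsympExpansion_self_and_seriesDiverges hr hrR hD hDne hDz hDz' hℓ hκ hb hΓ hG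
    (PsiT_eq μ) (prefE_mul μ)
  refine ⟨c1, c2.1, c2.2, c3.1, c3.2, fun hμ => ?_, ?_⟩
  · obtain ⟨d1, d2, d3, d4⟩ := c4 hμ
    exact ⟨d1, d2, d3, fun hz => d4 (sub_ne_zero.2 hz)⟩
  · rintro rfl
    exact euler_interp_of_eq_one hDe hD0 hDp (fun w hw => (hℓ w hw).2.1)
      fun w hw => taylorContinuation_eq hℓ hΓ hw

theorem PhiT_eq_zero_of_le {m : ℕ} (hm : 0 < m) {k : ℕ} (n : ℕ) (hk : m ≤ k) :
    PhiT m k n = 0 := by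
  rw [PhiT_eq, expansionTerm_eq_zero_of_le _ hm hk, mul_zero]

theorem PsiT_eq_zero_of_le {m : ℕ} (hm : 0 < m) {k : ℕ} (n : ℕ) (hk : m ≤ k) :
    PsiT m k n = 0 := by
  rw [PsiT_eq, expansionTerm_eq_zero_of_le _ hm hk, mul_zero]

theorem bernoulli_fourier_terms {z : ℂ} (hα : alphaT 1 z 0 = -Complex.cos (2 * Real.pi * z))
    (hβ : betaT 1 z 0 = -Complex.sin (2 * Real.pi * z) / (2 * Real.pi)) (n : ℕ) :
    PhiT 1 0 n = (-1) ^ n / (2 * (Real.pi : ℂ)) ^ (2 * n + 2) ∧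
      ∀ N : ℕ, 1 ≤ N →
        prefB 1 (2 * n) * ∑ k ∈ Finset.range N, alphaT 1 z k * PhiT 1 k n =
          2 * (-1) ^ (n + 1) * ((2 * n)! : ℂ) *
            (Complex.cos (2 * Real.pi * z) / (2 * (Real.pi : ℂ)) ^ (2 * n)) ∧
        prefB 1 (2 * n + 1) * ∑ k ∈ Finset.range N, betaT 1 z k * PhiT 1 k n =
          2 * (-1) ^ (n + 1) * ((2 * n + 1)! : ℂ) *
            (Complex.sin (2 * Real.pi * z) / (2 * (Real.pi : ℂ)) ^ (2 * n + 1)) := by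
  have hπ : (Real.pi : ℂ) ≠ 0 := by simp [Real.pi_ne_zero]
  have hv : ∀ k, 1 ≤ k → PhiT 1 k n = 0 := fun k hk => by
    simpa using PhiT_eq_zero_of_le one_pos n hk
  refine ⟨PhiT_one_zero n, fun N hN => ⟨?_, ?_⟩⟩
  · rw [sum_range_eq_first hv hN, hα, PhiT_one_zero, prefB_one, pow_succ (-1 : ℂ), pow_add]
    field_simp
    ring
  · rw [sum_range_eq_first hv hN, hβ, PhiT_one_zero, prefB_one, pow_succ (-1 : ℂ), pow_add, pow_add]
    field_simp
    ring

theorem euler_fourier_terms {z : ℂ} (hγ : gammaT 1 z 0 = Complex.sin (Real.pi * z))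
    (hδ : deltaT 1 z 0 = -Complex.cos (Real.pi * z) / Real.pi) (n : ℕ) :
    PsiT 1 0 n = (-1) ^ n / (Real.pi : ℂ) ^ (2 * n + 2) ∧
      ∀ N : ℕ, 1 ≤ N →
        prefE 1 (2 * n) * ∑ k ∈ Finset.range N, gammaT 1 z k * PsiT 1 k n =
          4 * ((2 * n)! : ℂ) * (Complex.sin (Real.pi * z - Real.pi * (2 * n : ℂ) / 2) /
              (Real.pi : ℂ) ^ (2 * n + 1)) ∧
        prefE 1 (2 * n + 1) * ∑ k ∈ Finset.range N, deltaT 1 z k * PsiT 1 k n =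
          4 * ((2 * n + 1)! : ℂ) * (Complex.sin (Real.pi * z - Real.pi * (2 * n + 1 : ℂ) / 2) /
              (Real.pi : ℂ) ^ (2 * n + 2)) := by
  have hπ : (Real.pi : ℂ) ≠ 0 := by simp [Real.pi_ne_zero]
  have hv : ∀ k, 1 ≤ k → PsiT 1 k n = 0 := fun k hk => by
    simpa using PsiT_eq_zero_of_le one_pos n hk
  have h1 : Complex.sin (Real.pi * z - Real.pi * (2 * n : ℂ) / 2) =
      (-1) ^ n * Complex.sin (Real.pi * z) := by
    rw [show (Real.pi * z - Real.pi * (2 * n : ℂ) / 2 : ℂ) = Real.pi * z - n * Real.pi by ring,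
      Complex.sin_antiperiodic.sub_nat_mul_eq]
  have h2 : Complex.sin (Real.pi * z - Real.pi * (2 * n + 1 : ℂ) / 2) =
      -((-1) ^ n * Complex.cos (Real.pi * z)) := by
    rw [show (Real.pi * z - Real.pi * (2 * n + 1 : ℂ) / 2 : ℂ) =
      (Real.pi * z - n * Real.pi) - Real.pi / 2 by ring, Complex.sin_sub_pi_div_two,
      Complex.cos_antiperiodic.sub_nat_mul_eq]
  refine ⟨PsiT_one_zero n, fun N hN => ⟨?_, ?_⟩⟩
  · rw [sum_range_eq_first hv hN, hγ, PsiT_one_zero, prefE_one, h1, pow_add, pow_add]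
    field_simp
  · rw [sum_range_eq_first hv hN, hδ, PsiT_one_zero, prefE_one, h2, pow_add]
    field_simp

end LargeDegree

end

theorem mainTheorem9 (μ z : ℂ) :
    -- Bernoulli: `f` is analytic in `|w| < 4π`, and given by the closed formula near `0`
    (AnalyticOnNhd ℂ (LargeDegree.f μ z) (Metric.ball 0 (4 * Real.pi)) ∧
      LargeDegree.f μ z =ᶠ[𝓝 0] LargeDegree.fGerm μ z) ∧
    -- its expansion near `±2πi`, and uniqueness of the coefficients
    (∀ᶠ w in 𝓝 (2 * (Real.pi : ℂ) * Complex.I) ⊔ 𝓝 (-(2 * (Real.pi : ℂ) * Complex.I)),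
      HasSum (fun k : ℕ => (LargeDegree.alphaT μ z k + w * LargeDegree.betaT μ z k) *
        ((w ^ 2 + 4 * (Real.pi : ℂ) ^ 2) / w ^ 2) ^ k) (LargeDegree.f μ z w)) ∧
    (∀ a b : ℕ → ℂ,
      (∀ᶠ w in 𝓝 (2 * (Real.pi : ℂ) * Complex.I) ⊔ 𝓝 (-(2 * (Real.pi : ℂ) * Complex.I)),
        HasSum (fun k : ℕ => (a k + w * b k) *
          ((w ^ 2 + 4 * (Real.pi : ℂ) ^ 2) / w ^ 2) ^ k) (LargeDegree.f μ z w)) →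
      a = LargeDegree.alphaT μ z ∧ b = LargeDegree.betaT μ z) ∧
    -- the Gamma function form of `Φ̃`
    (∀ k n : ℕ, (∀ j : ℕ, μ + n ≠ -(j : ℂ)) →
      LargeDegree.PhiT μ k n = (-1) ^ (n + k) *
        (2 * (Real.pi : ℂ)) ^ (-2 * μ - 2 * (n : ℂ)) *
          (Complex.Gamma (μ + n) / (Complex.Gamma (μ - k) * ((n + k)! : ℂ)))) ∧
    -- asymptotic expansions, for every `μ`, in the scale `(2π)^{-2n} n^{μ-k-1}`
    LargeDegree.HasAsympExpansion (fun n => LargeDegree.genBernoulli μ (2 * n) z)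
      (LargeDegree.alphaT μ z)
      (fun k n => LargeDegree.prefB μ (2 * n) * LargeDegree.PhiT μ k n)
      (fun k n => ((2 * n)! : ℂ) / (2 * (Real.pi : ℂ)) ^ (2 * n) * (n : ℂ) ^ (μ - k - 1)) ∧
    LargeDegree.HasAsympExpansion (fun n => LargeDegree.genBernoulli μ (2 * n + 1) z)
      (LargeDegree.betaT μ z)
      (fun k n => LargeDegree.prefB μ (2 * n + 1) * LargeDegree.PhiT μ k n)
      (fun k n => ((2 * n + 1)! : ℂ) / (2 * (Real.pi : ℂ)) ^ (2 * n) *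
        (n : ℂ) ^ (μ - k - 1)) ∧
    -- for non-integer `μ`: the terms themselves form the scale, and the series diverge
    ((∀ m : ℤ, μ ≠ m) →
      LargeDegree.HasAsympExpansion (fun n => LargeDegree.genBernoulli μ (2 * n) z)
        (LargeDegree.alphaT μ z)
        (fun k n => LargeDegree.prefB μ (2 * n) * LargeDegree.PhiT μ k n)
        (fun k n => LargeDegree.prefB μ (2 * n) * LargeDegree.PhiT μ k n) ∧
      LargeDegree.HasAsympExpansion (fun n => LargeDegree.genBernoulli μ (2 * n + 1) z)
        (LargeDegree.betaT μ z)
        (fun k n => LargeDegree.prefB μ (2 * n + 1) * LargeDegree.PhiT μ k n)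
        (fun k n => LargeDegree.prefB μ (2 * n + 1) * LargeDegree.PhiT μ k n) ∧
      (∀ n : ℕ, LargeDegree.SeriesDiverges
        (fun k => LargeDegree.alphaT μ z k * LargeDegree.PhiT μ k n)) ∧
      (z ≠ μ / 2 → ∀ n : ℕ, LargeDegree.SeriesDiverges
        (fun k => LargeDegree.betaT μ z k * LargeDegree.PhiT μ k n))) ∧
    -- integer `μ`
    (∀ m : ℕ, 0 < m → μ = m → ∀ k n : ℕ, m ≤ k → LargeDegree.PhiT μ k n = 0) ∧
    (∀ m : ℕ, μ = -(m : ℂ) → ∀ k n : ℕ, m < n → LargeDegree.PhiT μ k n = 0) ∧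
    -- `μ = 1`: the leading Fourier terms
    (μ = 1 → ∀ n : ℕ,
      LargeDegree.PhiT μ 0 n = (-1) ^ n / (2 * (Real.pi : ℂ)) ^ (2 * n + 2) ∧
      ∀ N : ℕ, 1 ≤ N →
        LargeDegree.prefB μ (2 * n) *
            ∑ k ∈ Finset.range N, LargeDegree.alphaT μ z k * LargeDegree.PhiT μ k n =
          2 * (-1) ^ (n + 1) * ((2 * n)! : ℂ) *
            (Complex.cos (2 * Real.pi * z) / (2 * (Real.pi : ℂ)) ^ (2 * n)) ∧
        LargeDegree.prefB μ (2 * n + 1) *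
            ∑ k ∈ Finset.range N, LargeDegree.betaT μ z k * LargeDegree.PhiT μ k n =
          2 * (-1) ^ (n + 1) * ((2 * n + 1)! : ℂ) *
            (Complex.sin (2 * Real.pi * z) / (2 * (Real.pi : ℂ)) ^ (2 * n + 1))) ∧
    -- Euler: `g` is analytic in `|w| < 3π`, and given by the closed formula near `0`
    (AnalyticOnNhd ℂ (LargeDegree.g μ z) (Metric.ball 0 (3 * Real.pi)) ∧
      LargeDegree.g μ z =ᶠ[𝓝 0] LargeDegree.gGerm μ z) ∧
    (∀ᶠ w in 𝓝 ((Real.pi : ℂ) * Complex.I) ⊔ 𝓝 (-((Real.pi : ℂ) * Complex.I)),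
      HasSum (fun k : ℕ => (LargeDegree.gammaT μ z k + w * LargeDegree.deltaT μ z k) *
        ((w ^ 2 + (Real.pi : ℂ) ^ 2) / w ^ 2) ^ k) (LargeDegree.g μ z w)) ∧
    (∀ a b : ℕ → ℂ,
      (∀ᶠ w in 𝓝 ((Real.pi : ℂ) * Complex.I) ⊔ 𝓝 (-((Real.pi : ℂ) * Complex.I)),
        HasSum (fun k : ℕ => (a k + w * b k) *
          ((w ^ 2 + (Real.pi : ℂ) ^ 2) / w ^ 2) ^ k) (LargeDegree.g μ z w)) →
      a = LargeDegree.gammaT μ z ∧ b = LargeDegree.deltaT μ z) ∧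
    (∀ k n : ℕ, (∀ j : ℕ, μ + n ≠ -(j : ℂ)) →
      LargeDegree.PsiT μ k n = (-1) ^ (n + k) *
        (Real.pi : ℂ) ^ (-2 * μ - 2 * (n : ℂ)) *
          (Complex.Gamma (μ + n) / (Complex.Gamma (μ - k) * ((n + k)! : ℂ)))) ∧
    LargeDegree.HasAsympExpansion (fun n => LargeDegree.genEuler μ (2 * n) z)
      (LargeDegree.gammaT μ z)
      (fun k n => LargeDegree.prefE μ (2 * n) * LargeDegree.PsiT μ k n)
      (fun k n => ((2 * n)! : ℂ) / (Real.pi : ℂ) ^ (2 * n) * (n : ℂ) ^ (μ - k - 1)) ∧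
    LargeDegree.HasAsympExpansion (fun n => LargeDegree.genEuler μ (2 * n + 1) z)
      (LargeDegree.deltaT μ z)
      (fun k n => LargeDegree.prefE μ (2 * n + 1) * LargeDegree.PsiT μ k n)
      (fun k n => ((2 * n + 1)! : ℂ) / (Real.pi : ℂ) ^ (2 * n) * (n : ℂ) ^ (μ - k - 1)) ∧
    ((∀ m : ℤ, μ ≠ m) →
      LargeDegree.HasAsympExpansion (fun n => LargeDegree.genEuler μ (2 * n) z)
        (LargeDegree.gammaT μ z)
        (fun k n => LargeDegree.prefE μ (2 * n) * LargeDegree.PsiT μ k n)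
        (fun k n => LargeDegree.prefE μ (2 * n) * LargeDegree.PsiT μ k n) ∧
      LargeDegree.HasAsympExpansion (fun n => LargeDegree.genEuler μ (2 * n + 1) z)
        (LargeDegree.deltaT μ z)
        (fun k n => LargeDegree.prefE μ (2 * n + 1) * LargeDegree.PsiT μ k n)
        (fun k n => LargeDegree.prefE μ (2 * n + 1) * LargeDegree.PsiT μ k n) ∧
      (∀ n : ℕ, LargeDegree.SeriesDiverges
        (fun k => LargeDegree.gammaT μ z k * LargeDegree.PsiT μ k n)) ∧
      (z ≠ μ / 2 → ∀ n : ℕ, LargeDegree.SeriesDiverges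
        (fun k => LargeDegree.deltaT μ z k * LargeDegree.PsiT μ k n))) ∧
    (∀ m : ℕ, 0 < m → μ = m → ∀ k n : ℕ, m ≤ k → LargeDegree.PsiT μ k n = 0) ∧
    (∀ m : ℕ, μ = -(m : ℂ) → ∀ k n : ℕ, m < n → LargeDegree.PsiT μ k n = 0) ∧
    (μ = 1 → ∀ n : ℕ,
      LargeDegree.PsiT μ 0 n = (-1) ^ n / (Real.pi : ℂ) ^ (2 * n + 2) ∧
      ∀ N : ℕ, 1 ≤ N →
        LargeDegree.prefE μ (2 * n) *
            ∑ k ∈ Finset.range N, LargeDegree.gammaT μ z k * LargeDegree.PsiT μ k n =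
          4 * ((2 * n)! : ℂ) *
            (Complex.sin (Real.pi * z - Real.pi * (2 * n : ℂ) / 2) /
              (Real.pi : ℂ) ^ (2 * n + 1)) ∧
        LargeDegree.prefE μ (2 * n + 1) *
            ∑ k ∈ Finset.range N, LargeDegree.deltaT μ z k * LargeDegree.PsiT μ k n =
          4 * ((2 * n + 1)! : ℂ) *
            (Complex.sin (Real.pi * z - Real.pi * (2 * n + 1 : ℂ) / 2) /
              (Real.pi : ℂ) ^ (2 * n + 2))) := by
  obtain ⟨b1, b2, b3, b4, b5, b6, b7⟩ := LargeDegree.bernoulli_expansion μ z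
  obtain ⟨e1, e2, e3, e4, e5, e6, e7⟩ := LargeDegree.euler_expansion μ z
  refine ⟨b1, b2, b3, ?_, b4, b5, b6, ?_, ?_, ?_, e1, e2, e3, ?_, e4, e5, e6, ?_, ?_, ?_⟩
  · intro k n h
    rw [LargeDegree.PhiT, mul_div_assoc,
      LargeDegree.ascPochhammer_div_factorial_eq_Gamma μ k n h]
  · rintro m hm rfl k n hk
    exact LargeDegree.PhiT_eq_zero_of_le hm n hk
  · rintro m rfl k n hn
    rw [LargeDegree.PhiT_eq, LargeDegree.expansionTerm_eq_zero_of_lt _ hn, mul_zero]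
  · rintro rfl n
    exact LargeDegree.bernoulli_fourier_terms (b7 rfl).1 (b7 rfl).2 n
  · intro k n h
    rw [LargeDegree.PsiT, mul_div_assoc,
      LargeDegree.ascPochhammer_div_factorial_eq_Gamma μ k n h]
  · rintro m hm rfl k n hk
    exact LargeDegree.PsiT_eq_zero_of_le hm n hk
  · rintro m rfl k n hn
    rw [LargeDegree.PsiT_eq, LargeDegree.expansionTerm_eq_zero_of_lt _ hn, mul_zero]
  · rintro rfl n
    exact LargeDegree.euler_fourier_terms (e7 rfl).1 (e7 rfl).2 n
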